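/- \textbf{Setting.} Consider an $n$-player game with strategy sets $\mathcal X_i\subset\mathbb R^{d_i}$ and cost functions $f_i:\mathcal X\to\mathbb R$, where $\mathcal X=\mathcal X_1\times\cdots\times\mathcal X_n$ and $d=\sum_{i=1}^n d_i$; all norms are Euclidean (or the induced operator norms). Write $\nabla_i$ for the gradient with respect to $x_i$ (taken within $\mathcal X_i$). Let $\alpha>0$, $\beta,L\ge 0$ and $r,R>0$ be constants such that: (a) each $\mathcal X_i$ is closed and convex, and $r\mathbb B\subseteq\mathcal X\subseteq R\mathbb B$, where $\mathbb B$ is the closed unit ball of $\mathbb R^d$; (b) for each $i$, $f_i(x_i,x_{-i})$ is convex and $C^1$ in $x_i\in\mathcal X_i$, and $x\mapsto\nabla_i f_i(x)$ is $\beta$-Lipschitz on $\mathcal X$; (c) for each $i$, the map $\nabla_i f_i$ is differentiable on $\mathcal X$ and its Jacobian is $L$-Lipschitz on $\mathcal X$ in operator norm (this is required only if $n>1$); (d) $g(x)=(\nabla_1f_1(x),\dots,\nabla_nf_n(x))$ satisfies $\langle g(x)-g(x'),x-x'\rangle\ge\alpha\|x-x'\|^2$ for all $x,x'\in\mathcal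 X$; (e) each $f_i$ is Borel measurable on $\mathcal X$, and $F_*:=\max_i\sup_{x\in\mathcal X}|f_i(x)|^2<\infty$. Let $x^\star$ be the Nash equilibrium of the game, i.e. $x^\star\in\mathcal X$ and $x_i^\star\in\arg\min_{x_i\in\mathcal X_i}f_i(x_i,x^\star_{-i})$ for every $i$. \textbf{Algorithm.} Given $\delta>0$, step sizes $\eta_t$ and a deterministic initial point $x^0\in(1-\delta)\mathcal X$, in each round $t=0,1,2,\dots$ every player $i$ samples $v_i^t$ uniformly from the unit sphere $\mathbb S_i$ of $\mathbb R^{d_i}$ (independently over all $i$ and $t$), plays $x_i^t+\delta v_i^t$, and updates $$\hat g_i^t=\tfrac{d_i}{\delta}f_i(x^t+\delta v^t)\,v_i^t,\qquad x_i^{t+1}=\mathrm{proj}_{(1-\delta)\mathcal X_i}\bigl(x_i^t-\eta_t\hat g_i^t\bigr),$$ where $x^t=(x_1^t,\dots,x_n^t)$ and $v^t=(v_1^t,\dots,v_n^t)$. \textbf{Claim.} Put $C=(\alpha+\beta\sqrt n)R+\beta n$. Let $$0<\varepsilon< C^2\cdot\min\Bigl\{\frac1{L^2n^3},\frac{4r^2}{\alpha^2}\Bigr\},\qquad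 \delta=\frac{\alpha\sqrt{\varepsilon/4}}{C},\qquad \eta_t=\frac{2}{\alpha t}\quad(t\ge1),$$ with $\eta_0$ arbitrary, where the term $1/(L^2n^3)$ is omitted from the minimum if $L=0$ or if $n=1$. Assume that the points played are feasible, in the sense that $(1-\delta)u+\delta s\in\mathcal X_i$ for all $i$, all $u\in\mathcal X_i$ and all $s\in\mathbb S_i$ (for $\delta\le 1$ this holds as soon as $r\ge 1$). Then $$\mathbb E\|x^t-x^\star\|^2\le\varepsilon\qquad\text{and}\qquad \mathbb E\|x^t+\delta v^t-x^\star\|^2\le\varepsilon$$ hold for all integers $$t\ \ge\ \frac{\max\bigl\{32\,\alpha^4\varepsilon R^2,\ 64\,\bigl((\alpha+\beta\sqrt n)R+\beta n+\sqrt n\,\alpha\bigr)^2F_*\,d^2\,n\bigr\}}{\alpha^4\varepsilon^2}.$$ -/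

import Mathlib

open MeasureTheory ProbabilityTheory
open scoped Pointwise

noncomputable section

namespace BanditGame

/-- The strategy space `ℝ^{d_i}` of one player, with the Euclidean norm. -/
abbrev Strat (m : ℕ) : Type := EuclideanSpace ℝ (Fin m)

/-- The joint strategy space `ℝ^d = ℝ^{d_1} × ⋯ × ℝ^{d_n}`, `d = ∑ d_i`, with the Euclidean norm. -/
abbrev Joint {n : ℕ} (d : Fin n → ℕ) : Type := PiLp 2 (fun i : Fin n => Strat (d i))

variable {n : ℕ} {d : Fin n → ℕ}

/-- The profile `(y, x_{-i})`: player `i` deviates from `x` to `y`. -/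
def deviate (x : Joint d) (i : Fin n) (y : Strat (d i)) : Joint d :=
  WithLp.toLp 2 (Function.update x.ofLp i y)

/-- The product `𝒳 = 𝒳_1 × ⋯ × 𝒳_n` inside `ℝ^d`. -/
def jointSet (X : ∀ i : Fin n, Set (Strat (d i))) : Set (Joint d) := {x | ∀ i, x i ∈ X i}

/-- `x` is a Nash equilibrium of the game with costs `f_i` and strategy sets `𝒳_i`. -/
def IsNash (X : ∀ i : Fin n, Set (Strat (d i))) (f : Fin n → Joint d → ℝ) (x : Joint d) : Prop :=
  ∀ i, x i ∈ X i ∧ ∀ y ∈ X i, f i x ≤ f i (deviate x i y)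

/-- The individual gradient `∇_i f_i(x)`: the gradient at `x_i` of `y ↦ f_i(y, x_{-i})`.
The cost is only meaningful on `𝒳`, so the derivative is taken within `𝒳_i`; it is unique because
`𝒳_i` is convex with nonempty interior. -/
def partialGrad (X : ∀ i : Fin n, Set (Strat (d i))) (f : Fin n → Joint d → ℝ) (i : Fin n)
    (x : Joint d) : Strat (d i) :=
  gradientWithin (fun y => f i (deviate x i y)) (X i) (x i)

/-- The map `g(x) = (∇_1 f_1(x), …, ∇_n f_n(x))`. -/
def gradMap (X : ∀ i : Fin n, Set (Strat (d i))) (f : Fin n → Joint d → ℝ) (x : Joint d) :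
    Joint d :=
  WithLp.toLp 2 (fun i => partialGrad X f i x)

/-- The set of all values `|f_i(x)|²`, `i ∈ {1, …, n}`, `x ∈ 𝒳`. -/
def sqCosts (X : ∀ i : Fin n, Set (Strat (d i))) (f : Fin n → Joint d → ℝ) : Set ℝ :=
  {c | ∃ i, ∃ x ∈ jointSet X, c = |f i x| ^ 2}

/-- `F_* = max_i max_{x ∈ 𝒳} |f_i(x)|²`. -/
def Fstar (X : ∀ i : Fin n, Set (Strat (d i))) (f : Fin n → Joint d → ℝ) : ℝ := sSup (sqCosts X f)

/-- The standing assumptions on the game. -/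
structure StandingAssumptions (X : ∀ i : Fin n, Set (Strat (d i))) (f : Fin n → Joint d → ℝ)
    (α β L r R : ℝ) : Prop where
  α_pos : 0 < α
  β_nonneg : 0 ≤ β
  L_nonneg : 0 ≤ L
  r_pos : 0 < r
  R_pos : 0 < R
  closed : ∀ i, IsClosed (X i)
  convex : ∀ i, Convex ℝ (X i)
  ball_subset : Metric.closedBall 0 r ⊆ jointSet X
  subset_ball : jointSet X ⊆ Metric.closedBall 0 R
  convex_cost : ∀ i, ∀ x ∈ jointSet X, ConvexOn ℝ (X i) (fun y => f i (deviate x i y))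
  smooth_cost : ∀ i, ∀ x ∈ jointSet X, ContDiffOn ℝ 1 (fun y => f i (deviate x i y)) (X i)
  lipschitz_grad : ∀ i, ∀ x ∈ jointSet X, ∀ x' ∈ jointSet X,
    ‖partialGrad X f i x - partialGrad X f i x'‖ ≤ β * ‖x - x'‖
  /-- Existence of the Jacobian of `∇_i f_i` on `𝒳`; not needed for a single player. -/
  differentiable_grad : 1 < n → ∀ i, DifferentiableOn ℝ (partialGrad X f i) (jointSet X)
  /-- Lipschitz continuity of that Jacobian; not needed for a single player. -/
  lipschitz_jacobian : 1 < n → ∀ i, ∀ x ∈ jointSet X, ∀ x' ∈ jointSet X,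
    ‖fderivWithin ℝ (partialGrad X f i) (jointSet X) x -
      fderivWithin ℝ (partialGrad X f i) (jointSet X) x'‖ ≤ L * ‖x - x'‖
  strongly_monotone : ∀ x ∈ jointSet X, ∀ x' ∈ jointSet X,
    α * ‖x - x'‖ ^ 2 ≤ inner ℝ (gradMap X f x - gradMap X f x') (x - x')
  /-- `F_*` is finite. -/
  bounded_cost : BddAbove (sqCosts X f)
  /-- The costs are Borel functions on `𝒳`, so that the expectations make sense. -/
  measurable_cost : ∀ i, Measurable (fun x : jointSet X => f i x)

/-- `p` is a point of `K` nearest to `z`. -/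
def IsNearest {E : Type*} [NormedAddCommGroup E] (K : Set E) (z p : E) : Prop :=
  p ∈ K ∧ ∀ y ∈ K, ‖z - p‖ ≤ ‖z - y‖

open Classical in
/-- The Euclidean projection onto `K`: the nearest point of `K`, which exists and is unique when
`K` is nonempty, closed and convex. -/
def proj {E : Type*} [NormedAddCommGroup E] (K : Set E) (z : E) : E :=
  if h : ∃ p, IsNearest K z p then h.choose else z

/-- The one-point gradient estimate `ĝ_i = (d_i / δ) f_i(x + δ v) v_i`. -/
def gradEst (f : Fin n → Joint d → ℝ) (δ : ℝ) (x v : Joint d) (i : Fin n) : Strat (d i) :=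
  ((d i : ℝ) / δ * f i (x + δ • v)) • v i

/-- Derivative free gradient play: the iterate `x^t` started at `x^0 = x₀` with step sizes `η`,
query radius `δ` and sampled directions `v^0, v^1, …`. -/
def dfo (X : ∀ i : Fin n, Set (Strat (d i))) (f : Fin n → Joint d → ℝ) (η : ℕ → ℝ) (δ : ℝ)
    (x₀ : Joint d) (v : ℕ → Joint d) : ℕ → Joint d
  | 0 => x₀
  | t + 1 => WithLp.toLp 2 (fun i => proj ((1 - δ) • X i)
      (dfo X f η δ x₀ v t i - η t • gradEst f δ (dfo X f η δ x₀ v t) (v t) i))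

/-- The uniform probability distribution on the unit sphere of `ℝ^m` (`m ≥ 1`): the normalized
surface measure, as a measure on `ℝ^m`. -/
def uniformSphere (m : ℕ) : Measure (Strat m) :=
  Measure.map (Subtype.val : Metric.sphere (0 : Strat m) 1 → Strat m)
    (((volume : Measure (Strat m)).toSphere Set.univ)⁻¹ • (volume : Measure (Strat m)).toSphere)

end BanditGame

end

namespace BanditGame

/-! ### The uniform distribution on the sphere -/

/-! The iteration is projected stochastic approximation aimed at the shrunk equilibrium `y = (1 - δ)
• xstar`, which lies in the set projected onto. Write `e = δ (β n + β √n R)` for the total linear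
error, `G = d² F_* / δ²` for the bound on the squared estimate, and `C` for the denominator of `δ`.

The bias of the one-point estimate is controlled by symmetry, without a smoothed cost or an
integration by parts on the sphere. Reflecting block `i` in the hyperplane orthogonal to a unit
vector `u` preserves the law of the directions and flips the sign of `⟨w i, u⟩`. So the integral of
`h w * ⟨w i, u⟩` equals half the integral of the increment of `h` under the reflection, times `⟨w i,
u⟩`. Both queried profiles differ only in block `i`, so the mean value inequality and the
`β`-Lipschitz partial gradient make the increment linear up to a factor `β √n δ`. As `⟨w i, u⟩ ^ 2`
has mean `1 / d i`, the estimate recovers the partial gradient with error at most `β √n δ`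
(`abs_integral_mul_inner_sub_le`, `abs_integral_inner_gradEst_sub_le`).

Strong monotonicity and the variational inequality at the equilibrium make `g` point away from `y`,
up to the cost `δ β √n R` of shrinking. Young's inequality absorbs all linear errors into half of
the monotonicity. Nonexpansiveness of the projection then gives, for `a t = 𝔼‖x^t - y‖²`, the
recursion `a (t+1) ≤ (1 - α η) a t + η e² / α + η² G`, where the current directions are averaged out
by Fubini because they are independent of the iterate. With `η = 2 / (α t)` this solves to `a t ≤ (e
/ α)² + 4 G / (α² (t - 1))`.

The choice of `δ` makes `e / α + δ R = √ε / 2` exactly. Returning from `y` to `xstar` leaves at most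
`3 ε / 4`, and the query noise adds `δ² n ≤ ε / 4`. This needs `ε < 4 R²`; for coarser `ε` the
diameter bound suffices. -/

theorem uniformSphere_isProbabilityMeasure {m : ℕ} (hm : m ≠ 0) :
    IsProbabilityMeasure (uniformSphere m) := by
  have : Nonempty (Fin m) := ⟨⟨0, Nat.pos_of_ne_zero hm⟩⟩
  have h0 : (volume : Measure (Strat m)).toSphere ≠ 0 := Measure.toSphere_ne_zero _
  constructor
  rw [uniformSphere, Measure.map_apply measurable_subtype_coe MeasurableSet.univ,
    Set.preimage_univ, Measure.smul_apply, smul_eq_mul]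
  exact ENNReal.inv_mul_cancel (fun h => h0 (Measure.measure_univ_eq_zero.1 h)) (measure_ne_top _ _)

/-- In dimension zero the unit sphere is empty and the measure vanishes. Hence the mere existence of
directions with this law forces every `d i` to be positive. -/
theorem ne_zero_of_isProbabilityMeasure {m : ℕ} (h : IsProbabilityMeasure (uniformSphere m)) :
    m ≠ 0 := by
  rintro rfl
  have h1 := h.measure_univ
  have h0 : (volume : Measure (Strat 0)).toSphere = 0 :=
    (Measure.toSphere_eq_zero_iff _).2 inferInstance
  simp [uniformSphere, h0] at h1

theorem uniformSphere_ae_norm_eq_one (m : ℕ) : ∀ᵐ s ∂(uniformSphere m), ‖s‖ = 1 := by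
  rw [uniformSphere, ae_map_iff measurable_subtype_coe.aemeasurable
    (measurableSet_eq_fun measurable_norm measurable_const)]
  exact Filter.Eventually.of_forall fun s => by simp

/-- Surface measure is Lebesgue measure of the cone over the set, which reduces symmetries of the
sphere to symmetries of volume. -/
theorem uniformSphere_apply {m : ℕ} {A : Set (Strat m)} (hA : MeasurableSet A) :
    uniformSphere m A = ((volume : Measure (Strat m)).toSphere Set.univ)⁻¹ *
      (m * volume (Set.Ioo (0 : ℝ) 1 • (Metric.sphere (0 : Strat m) 1 ∩ A))) := by
  rw [uniformSphere, Measure.map_apply measurable_subtype_coe hA, Measure.smul_apply,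
    Measure.toSphere_apply' _ (measurable_subtype_coe hA), Subtype.image_preimage_coe]
  simp

/-- A linear isometry carries cones over subsets of the sphere to such cones and preserves their
volume. -/
theorem uniformSphere_measurePreserving {m : ℕ} (T : Strat m ≃ₗᵢ[ℝ] Strat m) :
    MeasurePreserving T (uniformSphere m) (uniformSphere m) := by
  refine ⟨T.continuous.measurable, ?_⟩
  ext A hA
  have hTA : MeasurableSet (T ⁻¹' A) := T.continuous.measurable hA
  rw [Measure.map_apply T.continuous.measurable hA, uniformSphere_apply hA,
    uniformSphere_apply hTA]
  have hset : Set.Ioo (0 : ℝ) 1 • (Metric.sphere (0 : Strat m) 1 ∩ T ⁻¹' A) =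
      T ⁻¹' (Set.Ioo (0 : ℝ) 1 • (Metric.sphere (0 : Strat m) 1 ∩ A)) := by
    ext z
    simp only [Set.mem_smul, Set.mem_preimage, Set.mem_inter_iff, mem_sphere_zero_iff_norm]
    constructor
    · rintro ⟨c, hc, s, ⟨hs, hsA⟩, rfl⟩
      exact ⟨c, hc, T s, ⟨by simpa using hs, hsA⟩, by simp⟩
    · rintro ⟨c, hc, s, ⟨hs, hsA⟩, h⟩
      exact ⟨c, hc, T.symm s, ⟨by simpa using hs, by simpa using hsA⟩,
        T.injective (by simpa using h)⟩
  have hmp : MeasurePreserving T.toMeasurableEquiv volume volume := T.measurePreserving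
  rw [hset]
  exact congrArg (fun c => _ * (_ * c)) (hmp.measure_preimage_equiv _)

theorem integrable_uniformSphere_of_bound {m : ℕ} (hm : m ≠ 0) {h : Strat m → ℝ}
    (hmeas : Measurable h) {B : ℝ} (hB : ∀ s, ‖s‖ = 1 → |h s| ≤ B) :
    Integrable h (uniformSphere m) := by
  have := uniformSphere_isProbabilityMeasure hm
  refine Integrable.of_bound hmeas.aestronglyMeasurable B ?_
  filter_upwards [uniformSphere_ae_norm_eq_one m] with s hs using hB s hs

/-- A reflection exchanges any two unit vectors, so all second moments agree; over an orthonormal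
basis they sum to the mean of `‖s‖ ^ 2 = 1`. -/
theorem integral_inner_sq_uniformSphere {m : ℕ} (hm : m ≠ 0) {u : Strat m} (hu : ‖u‖ = 1) :
    ∫ s, inner ℝ s u ^ 2 ∂(uniformSphere m) = 1 / m := by
  have := uniformSphere_isProbabilityMeasure hm
  have hconst : ∀ w : Strat m, ‖w‖ = 1 →
      ∫ s, inner ℝ s w ^ 2 ∂(uniformSphere m) = ∫ s, inner ℝ s u ^ 2 ∂(uniformSphere m) := by
    intro w hw
    set T := (ℝ ∙ (u - w))ᗮ.reflection with hT
    have hTu : T u = w := Submodule.reflection_sub (hu.trans hw.symm)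
    rw [← (uniformSphere_measurePreserving T).integral_comp'
      (f := T.toHomeomorph.toMeasurableEquiv) (g := fun s => inner ℝ s w ^ 2)]
    refine integral_congr_ae (Filter.Eventually.of_forall fun s => ?_)
    change inner ℝ (T s) w ^ 2 = _
    rw [← hTu, T.inner_map_map]
  have hint : ∀ w : Strat m, Integrable (fun s => inner ℝ s w ^ 2) (uniformSphere m) := by
    intro w
    refine integrable_uniformSphere_of_bound hm (by fun_prop) (B := ‖w‖ ^ 2) fun s hs => ?_
    rw [abs_pow]
    have := abs_real_inner_le_norm s w
    rw [hs, one_mul] at this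
    gcongr
  have hsum : ∑ j : Fin m, ∫ s, inner ℝ s (EuclideanSpace.basisFun (Fin m) ℝ j) ^ 2
      ∂(uniformSphere m) = 1 := by
    rw [← integral_finsetSum _ fun j _ => hint _]
    rw [integral_congr_ae (g := fun _ => (1 : ℝ))]
    · simp
    · filter_upwards [uniformSphere_ae_norm_eq_one m] with s hs
      have := (EuclideanSpace.basisFun (Fin m) ℝ).sum_sq_inner_left s
      rw [this, hs, one_pow]
  rw [Finset.sum_congr rfl fun j _ => hconst _
    ((EuclideanSpace.basisFun (Fin m) ℝ).orthonormal.1 j)] at hsum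
  have : (m : ℝ) ≠ 0 := by exact_mod_cast hm
  simp at hsum
  field_simp
  linarith

/-! ### Products of spheres and block reflections -/

variable {n : ℕ} {d : Fin n → ℕ}

/-- The joint law of one round of directions, as a product measure. -/
noncomputable def sphereProd (d : Fin n → ℕ) : Measure (∀ i, Strat (d i)) :=
  Measure.pi fun i => uniformSphere (d i)

theorem sphereProd_isProbabilityMeasure (hd : ∀ i, d i ≠ 0) :
    IsProbabilityMeasure (sphereProd d) := by
  have := fun i => uniformSphere_isProbabilityMeasure (hd i)
  unfold sphereProd
  infer_instance

theorem measurePreserving_eval_sphereProd (hd : ∀ i, d i ≠ 0) (i : Fin n) :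
    MeasurePreserving (Function.eval i) (sphereProd d) (uniformSphere (d i)) := by
  have := fun i => uniformSphere_isProbabilityMeasure (hd i)
  exact measurePreserving_eval _ i

theorem sphereProd_ae_norm_eq_one (hd : ∀ i, d i ≠ 0) :
    ∀ᵐ w ∂(sphereProd d), ∀ i, ‖w i‖ = 1 :=
  ae_all_iff.2 fun i => (measurePreserving_eval_sphereProd hd i).quasiMeasurePreserving.ae
    (uniformSphere_ae_norm_eq_one (d i))

theorem integrable_sphereProd_of_bound (hd : ∀ i, d i ≠ 0) {h : (∀ i, Strat (d i)) → ℝ}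
    (hmeas : Measurable h) {B : ℝ} (hB : ∀ w, (∀ i, ‖w i‖ = 1) → |h w| ≤ B) :
    Integrable h (sphereProd d) := by
  have := sphereProd_isProbabilityMeasure hd
  refine Integrable.of_bound hmeas.aestronglyMeasurable B ?_
  filter_upwards [sphereProd_ae_norm_eq_one hd] with s hs using hB s hs

theorem integral_inner_sq_sphereProd (hd : ∀ i, d i ≠ 0) (i : Fin n) {u : Strat (d i)}
    (hu : ‖u‖ = 1) : ∫ w, inner ℝ (w i) u ^ 2 ∂(sphereProd d) = 1 / d i := by
  rw [← integral_inner_sq_uniformSphere (hd i) hu, ← (measurePreserving_eval_sphereProd hd i).map_eq,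
    integral_map (measurable_pi_apply i).aemeasurable (by fun_prop)]

/-- Apply the reflection in the hyperplane orthogonal to `u` to the `i`-th block. -/
noncomputable def reflectBlock (i : Fin n) (u : Strat (d i)) (w : ∀ i, Strat (d i)) :
    ∀ i, Strat (d i) :=
  Function.update w i ((ℝ ∙ u)ᗮ.reflection (w i))

theorem reflectBlock_apply_self (i : Fin n) {u : Strat (d i)} (hu : ‖u‖ = 1)
    (w : ∀ i, Strat (d i)) : reflectBlock i u w i = w i - (2 * inner ℝ (w i) u) • u := by
  rw [reflectBlock, Function.update_self, Submodule.reflection_orthogonal_apply,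
    Submodule.reflection_singleton_apply, hu, real_inner_comm]
  simp [mul_smul, two_smul]

theorem inner_reflectBlock (i : Fin n) {u : Strat (d i)} (hu : ‖u‖ = 1) (w : ∀ i, Strat (d i)) :
    inner ℝ (reflectBlock i u w i) u = -inner ℝ (w i) u := by
  rw [reflectBlock_apply_self i hu, inner_sub_left, inner_smul_left, real_inner_self_eq_norm_sq, hu]
  simp
  ring

theorem norm_reflectBlock_apply (i j : Fin n) (u : Strat (d i)) (w : ∀ i, Strat (d i)) :
    ‖reflectBlock i u w j‖ = ‖w j‖ := by
  rcases eq_or_ne j i with rfl | h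
  · simp [reflectBlock]
  · simp [reflectBlock, h]

theorem measurePreserving_reflectBlock (hd : ∀ i, d i ≠ 0) (i : Fin n) (u : Strat (d i)) :
    MeasurePreserving (reflectBlock i u) (sphereProd d) (sphereProd d) := by
  have := fun i => uniformSphere_isProbabilityMeasure (hd i)
  have key := measurePreserving_pi (fun j => uniformSphere (d j)) (fun j => uniformSphere (d j))
    (f := fun j => Function.update (β := fun j => Strat (d j) → Strat (d j)) (fun _ => id) i
      ((ℝ ∙ u)ᗮ.reflection) j) (fun j => by
      rcases eq_or_ne j i with rfl | h
      · simpa using uniformSphere_measurePreserving _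
      · simpa [h] using MeasurePreserving.id _)
  refine (?_ : reflectBlock i u = _) ▸ key
  ext1 w
  funext j
  rcases eq_or_ne j i with rfl | h
  · simp [reflectBlock]
  · simp [reflectBlock, h]

/-- The one-point estimate of a function whose increments across the `i`-th block are nearly linear
with slope `c` in direction `u` recovers the slope. -/
theorem abs_integral_mul_inner_sub_le (hd : ∀ i, d i ≠ 0) (i : Fin n) {u : Strat (d i)}
    (hu : ‖u‖ = 1) {h : (∀ i, Strat (d i)) → ℝ} (hmeas : Measurable h) {B : ℝ}
    (hB : ∀ w, (∀ i, ‖w i‖ = 1) → |h w| ≤ B) {c M : ℝ}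
    (hM : ∀ w, (∀ i, ‖w i‖ = 1) →
      |h w - h (reflectBlock i u w) - c * (2 * inner ℝ (w i) u)| ≤ M * |2 * inner ℝ (w i) u|) :
    |∫ w, h w * inner ℝ (w i) u ∂(sphereProd d) - c / d i| ≤ M / d i := by
  have hin : ∀ w : ∀ i, Strat (d i), (∀ i, ‖w i‖ = 1) → |inner ℝ (w i) u| ≤ 1 := by
    intro w hw
    have := abs_real_inner_le_norm (w i) u
    rwa [hw, hu, one_mul] at this
  have hrm := measurePreserving_reflectBlock hd i u
  have hi1 : Integrable (fun w => h w * inner ℝ (w i) u) (sphereProd d) := by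
    refine integrable_sphereProd_of_bound hd (by fun_prop) (B := B) fun w hw => ?_
    rw [abs_mul]
    have h1 := hB w hw
    have h2 := hin w hw
    nlinarith [abs_nonneg (h w), abs_nonneg (inner ℝ (w i) u)]
  have hi2 : Integrable (fun w => inner ℝ (w i) u ^ 2) (sphereProd d) := by
    refine integrable_sphereProd_of_bound hd (by fun_prop) (B := 1) fun w hw => ?_
    rw [abs_pow]
    exact pow_le_one₀ (abs_nonneg _) (hin w hw)
  have hi3 : Integrable (fun w => h (reflectBlock i u w) * inner ℝ (w i) u) (sphereProd d) := by
    have hmeas' := hmeas.comp hrm.measurable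
    refine integrable_sphereProd_of_bound hd (hmeas'.mul (by fun_prop)) (B := B) fun w hw => ?_
    rw [abs_mul]
    have h1 := hB (reflectBlock i u w) fun j => by rw [norm_reflectBlock_apply, hw]
    have h2 := hin w hw
    nlinarith [abs_nonneg (h (reflectBlock i u w)), abs_nonneg (inner ℝ (w i) u)]
  -- The reflection preserves the law and negates the inner product; averaging the two expressions
  -- leaves only the increment of `h`.
  have hrefl : ∫ w, h w * inner ℝ (w i) u ∂(sphereProd d) =
      -∫ w, h (reflectBlock i u w) * inner ℝ (w i) u ∂(sphereProd d) := by
    conv_lhs => rw [← hrm.map_eq]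
    rw [integral_map hrm.measurable.aemeasurable
      (Measurable.aestronglyMeasurable (by fun_prop)), ← integral_neg]
    refine integral_congr_ae (Filter.Eventually.of_forall fun w => ?_)
    simp only [inner_reflectBlock i hu]
    ring
  have hsq := integral_inner_sq_sphereProd hd i hu
  have heq : ∫ w, h w * inner ℝ (w i) u ∂(sphereProd d) - c / d i =
      ∫ w, (h w - h (reflectBlock i u w) - c * (2 * inner ℝ (w i) u)) * inner ℝ (w i) u / 2
        ∂(sphereProd d) := by
    have : ∀ w : ∀ i, Strat (d i),
        (h w - h (reflectBlock i u w) - c * (2 * inner ℝ (w i) u)) * inner ℝ (w i) u / 2 =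
        1 / 2 * (h w * inner ℝ (w i) u - h (reflectBlock i u w) * inner ℝ (w i) u) -
          c * inner ℝ (w i) u ^ 2 := fun w => by ring
    simp_rw [this]
    have hi13 : Integrable (fun w => 1 / 2 * (h w * inner ℝ (w i) u -
        h (reflectBlock i u w) * inner ℝ (w i) u)) (sphereProd d) := (hi1.sub hi3).const_mul _
    rw [integral_sub hi13 (hi2.const_mul c), integral_const_mul,
      integral_const_mul, integral_sub hi1 hi3, hsq]
    rw [mul_one_div]
    linarith [hrefl]
  rw [heq]
  have hdpos : (0 : ℝ) < d i := by exact_mod_cast Nat.pos_of_ne_zero (hd i)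
  calc _ ≤ ∫ w, M * inner ℝ (w i) u ^ 2 ∂(sphereProd d) := by
        rw [← Real.norm_eq_abs]
        refine norm_integral_le_of_norm_le (hi2.const_mul M) ?_
        filter_upwards [sphereProd_ae_norm_eq_one hd] with w hw
        rw [Real.norm_eq_abs, abs_div, abs_mul, abs_two]
        have h1 := hM w hw
        rw [abs_mul 2, abs_two] at h1
        rw [← sq_abs]
        nlinarith [abs_nonneg (inner ℝ (w i) u)]
    _ = M / d i := by rw [integral_const_mul, hsq]; ring

/-- The constant function has no increments, so its recovered slope is zero. -/
theorem integral_inner_sphereProd (hd : ∀ i, d i ≠ 0) (i : Fin n) (e : Strat (d i)) :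
    ∫ w, inner ℝ (w i) e ∂(sphereProd d) = 0 := by
  rcases eq_or_ne e 0 with rfl | he
  · simp
  have hu : ‖(‖e‖⁻¹ • e)‖ = 1 := norm_smul_inv_norm (𝕜 := ℝ) he
  have key := abs_integral_mul_inner_sub_le hd i hu (h := fun _ => 1) measurable_const (B := 1)
    (by simp) (c := 0) (M := 0) (by simp)
  have h0 : ∫ w, inner ℝ (w i) (‖e‖⁻¹ • e) ∂(sphereProd d) = 0 := by simpa using key
  simp_rw [real_inner_smul_right, integral_const_mul] at h0
  exact (mul_eq_zero.1 h0).resolve_left (by simpa using he)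


/-! ### Deterministic consequences of the standing assumptions -/

theorem deviate_apply_self (x : Joint d) (i : Fin n) (y : Strat (d i)) : deviate x i y i = y := by
  simp [deviate]

theorem deviate_apply_of_ne (x : Joint d) {i j : Fin n} (h : j ≠ i) (y : Strat (d i)) :
    deviate x i y j = x j := by
  simp [deviate, h]

theorem deviate_deviate (x : Joint d) (i : Fin n) (y z : Strat (d i)) :
    deviate (deviate x i y) i z = deviate x i z := by
  simp [deviate]

theorem deviate_mem {X : ∀ i : Fin n, Set (Strat (d i))} {x : Joint d} (hx : x ∈ jointSet X)
    {i : Fin n} {y : Strat (d i)} (hy : y ∈ X i) : deviate x i y ∈ jointSet X := by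
  intro j
  rcases eq_or_ne j i with rfl | h
  · rwa [deviate_apply_self]
  · rw [deviate_apply_of_ne x h]
    exact hx j

theorem norm_le_sqrt_mul_of_forall_norm_le {x : Joint d} {c : ℝ} (hc : 0 ≤ c)
    (h : ∀ i, ‖x i‖ ≤ c) : ‖x‖ ≤ √(n : ℝ) * c := by
  rw [← Real.sqrt_sq hc, ← Real.sqrt_mul (Nat.cast_nonneg n)]
  refine Real.le_sqrt_of_sq_le ?_
  rw [PiLp.norm_sq_eq_of_L2]
  calc ∑ i, ‖x i‖ ^ 2 ≤ ∑ _i : Fin n, c ^ 2 :=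
        Finset.sum_le_sum fun i _ => pow_le_pow_left₀ (norm_nonneg _) (h i) 2
    _ = n * c ^ 2 := by simp

theorem sum_norm_le_sqrt_mul_norm (x : Joint d) : ∑ i, ‖x i‖ ≤ √(n : ℝ) * ‖x‖ := by
  rw [← Real.sqrt_sq (norm_nonneg x), ← Real.sqrt_mul (Nat.cast_nonneg n), PiLp.norm_sq_eq_of_L2]
  refine Real.le_sqrt_of_sq_le ?_
  simpa using sq_sum_le_card_mul_sum_sq (s := Finset.univ) (f := fun i => ‖x i‖)

section
variable {X : ∀ i : Fin n, Set (Strat (d i))} {f : Fin n → Joint d → ℝ} {α β L r R : ℝ}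

theorem StandingAssumptions.zero_mem (hg : StandingAssumptions X f α β L r R) :
    (0 : Joint d) ∈ jointSet X :=
  hg.ball_subset (by simpa using hg.r_pos.le)

theorem StandingAssumptions.norm_le (hg : StandingAssumptions X f α β L r R) {x : Joint d}
    (hx : x ∈ jointSet X) : ‖x‖ ≤ R := by
  simpa using hg.subset_ball hx

theorem StandingAssumptions.isClosed_jointSet (hg : StandingAssumptions X f α β L r R) :
    IsClosed (jointSet X) := by
  have : jointSet X = ⋂ i, (fun x : Joint d => x i) ⁻¹' X i := by
    ext x
    simp [jointSet]
  rw [this]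
  exact isClosed_iInter fun i => (hg.closed i).preimage (by fun_prop)

theorem StandingAssumptions.smul_mem (hg : StandingAssumptions X f α β L r R) {x : Joint d}
    (hx : x ∈ jointSet X) {c : ℝ} (hc0 : 0 ≤ c) (hc1 : c ≤ 1) : c • x ∈ jointSet X := fun i =>
  (hg.convex i).smul_mem_of_zero_mem (hg.zero_mem i) (hx i) ⟨hc0, hc1⟩

theorem StandingAssumptions.sq_abs_cost_le (hg : StandingAssumptions X f α β L r R) (i : Fin n)
    {x : Joint d} (hx : x ∈ jointSet X) : |f i x| ^ 2 ≤ Fstar X f :=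
  le_csSup hg.bounded_cost ⟨i, x, hx, rfl⟩

theorem Fstar_nonneg (X : ∀ i : Fin n, Set (Strat (d i))) (f : Fin n → Joint d → ℝ) :
    0 ≤ Fstar X f := by
  refine Real.sSup_nonneg ?_
  rintro _ ⟨i, x, -, rfl⟩
  positivity

theorem StandingAssumptions.hasFDerivWithinAt (hg : StandingAssumptions X f α β L r R)
    {x : Joint d} (hx : x ∈ jointSet X) {i : Fin n} {y : Strat (d i)} (hy : y ∈ X i) :
    HasFDerivWithinAt (fun y => f i (deviate x i y))
      (InnerProductSpace.toDual ℝ _ (partialGrad X f i (deviate x i y))) (X i) y := by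
  have h := (((hg.smooth_cost i x hx).differentiableOn one_ne_zero) y hy).hasGradientWithinAt
  simpa only [partialGrad, deviate_deviate, deviate_apply_self] using! h.hasFDerivWithinAt

/-- The first-order optimality condition of each player over the convex set `X i`, summed over the
players. -/
theorem StandingAssumptions.inner_gradMap_nash_nonneg (hg : StandingAssumptions X f α β L r R)
    {xs : Joint d} (hxs : IsNash X f xs) {x : Joint d} (hx : x ∈ jointSet X) :
    0 ≤ inner ℝ (gradMap X f xs) (x - xs) := by
  rw [PiLp.inner_apply]
  refine Finset.sum_nonneg fun i _ => ?_
  have hmem : xs ∈ jointSet X := fun i => (hxs i).1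
  have hself : deviate xs i (xs i) = xs := by simp [deviate]
  have hmin : IsLocalMinOn (fun y => f i (deviate xs i y)) (X i) (xs i) := by
    refine IsMinOn.localize fun y hy => ?_
    simpa [hself] using (hxs i).2 y hy
  have := hmin.hasFDerivWithinAt_nonneg (hg.hasFDerivWithinAt hmem (hxs i).1)
    (sub_mem_posTangentConeAt_of_segment_subset ((hg.convex i).segment_subset (hxs i).1 (hx i)))
  rw [hself] at this
  exact this

theorem StandingAssumptions.norm_gradMap_sub_le (hg : StandingAssumptions X f α β L r R)
    {x x' : Joint d} (hx : x ∈ jointSet X) (hx' : x' ∈ jointSet X) :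
    ‖gradMap X f x - gradMap X f x'‖ ≤ √(n : ℝ) * (β * ‖x - x'‖) :=
  norm_le_sqrt_mul_of_forall_norm_le (mul_nonneg hg.β_nonneg (norm_nonneg _))
    fun i => hg.lipschitz_grad i x hx x' hx'

/-- Compare the lower and upper bounds for the increment of `g` between the origin and a point of
norm `r` on a coordinate axis. This makes `C` large enough relative to `α R` and `α √n` for `δ` to
be small. -/
theorem StandingAssumptions.strong_monotonicity_le_lipschitz
    (hg : StandingAssumptions X f α β L r R) (hn : n ≠ 0) (hd : ∀ i, d i ≠ 0) :
    α ≤ β * √(n : ℝ) := by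
  let i : Fin n := ⟨0, Nat.pos_of_ne_zero hn⟩
  let j : Fin (d i) := ⟨0, Nat.pos_of_ne_zero (hd i)⟩
  set x : Joint d := PiLp.single 2 i (PiLp.single 2 j r) with hxdef
  have hxn : ‖x‖ = r := by
    rw [hxdef, PiLp.norm_single, PiLp.norm_single, Real.norm_of_nonneg hg.r_pos.le]
  have hx : x ∈ jointSet X := hg.ball_subset (by simp [hxn])
  have h1 := hg.strongly_monotone x hx 0 hg.zero_mem
  have h2 := real_inner_le_norm (gradMap X f x - gradMap X f 0) (x - 0)
  have h3 := hg.norm_gradMap_sub_le hx hg.zero_mem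
  rw [sub_zero, hxn] at *
  have hr := hg.r_pos
  have h4 : α * r ^ 2 ≤ (β * √(n : ℝ)) * r ^ 2 := by nlinarith
  exact le_of_mul_le_mul_right h4 (by positivity)

/-- First-order expansion of the cost in the own strategy, uniformly near `x`. -/
theorem StandingAssumptions.abs_cost_sub_le (hg : StandingAssumptions X f α β L r R)
    {x z : Joint d} (hx : x ∈ jointSet X) (hz : z ∈ jointSet X) {δ : ℝ} (hδ : 0 ≤ δ)
    (hzx : ∀ j, ‖z j - x j‖ ≤ δ) {i : Fin n} {a b : Strat (d i)} (ha : a ∈ X i) (hb : b ∈ X i)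
    (hax : ‖a - x i‖ ≤ δ) (hbx : ‖b - x i‖ ≤ δ) :
    |f i (deviate z i a) - f i (deviate z i b) - inner ℝ (partialGrad X f i x) (a - b)| ≤
      β * (√(n : ℝ) * δ) * ‖a - b‖ := by
  -- Within this convex set every profile `deviate z i y` has all blocks within `δ` of those of `x`,
  -- hence lies within `√n δ` of `x`.
  set s := X i ∩ Metric.closedBall (x i) δ
  have hs : Convex ℝ s := (hg.convex i).inter (convex_closedBall _ _)
  have hder : ∀ y ∈ s, HasFDerivWithinAt (fun y => f i (deviate z i y))
      (InnerProductSpace.toDual ℝ _ (partialGrad X f i (deviate z i y))) s y := fun y hy =>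
    (hg.hasFDerivWithinAt hz hy.1).mono Set.inter_subset_left
  have hbound : ∀ y ∈ s, ‖InnerProductSpace.toDual ℝ _ (partialGrad X f i (deviate z i y)) -
      InnerProductSpace.toDual ℝ _ (partialGrad X f i x)‖ ≤ β * (√(n : ℝ) * δ) := by
    intro y hy
    rw [← map_sub, LinearIsometryEquiv.norm_map]
    refine (hg.lipschitz_grad i _ (deviate_mem hz hy.1) x hx).trans ?_
    refine mul_le_mul_of_nonneg_left (norm_le_sqrt_mul_of_forall_norm_le hδ fun j => ?_) hg.β_nonneg
    rw [PiLp.sub_apply]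
    rcases eq_or_ne j i with rfl | h
    · rw [deviate_apply_self]
      simpa [dist_eq_norm] using hy.2
    · rw [deviate_apply_of_ne z h]
      exact hzx j
  have := hs.norm_image_sub_le_of_norm_hasFDerivWithin_le' hder hbound
    (x := b) (y := a) ⟨hb, by simpa [dist_eq_norm] using hbx⟩ ⟨ha, by simpa [dist_eq_norm] using hax⟩
  simpa using this

end


/-! ### The Euclidean projection -/

section
variable {E : Type*} [NormedAddCommGroup E] [InnerProductSpace ℝ E] [CompleteSpace E] {K : Set E}

theorem isNearest_proj (hne : K.Nonempty) (hc : IsClosed K) (hK : Convex ℝ K) (z : E) :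
    IsNearest K z (proj K z) := by
  obtain ⟨p, hp, h⟩ := exists_norm_eq_iInf_of_complete_convex hne hc.isComplete hK z
  have hex : ∃ p, IsNearest K z p := by
    refine ⟨p, hp, fun y hy => ?_⟩
    rw [h]
    exact ciInf_le ⟨0, by rintro _ ⟨w, rfl⟩; exact norm_nonneg _⟩ (⟨y, hy⟩ : K)
  rw [proj, dif_pos hex]
  exact hex.choose_spec

theorem inner_sub_proj_nonpos (hc : IsClosed K) (hK : Convex ℝ K) (z : E) {y : E}
    (hy : y ∈ K) : inner ℝ (z - proj K z) (y - proj K z) ≤ 0 := by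
  have hp := isNearest_proj ⟨y, hy⟩ hc hK z
  have : Nonempty K := ⟨⟨y, hy⟩⟩
  refine (norm_eq_iInf_iff_real_inner_le_zero hK hp.1).1 (le_antisymm ?_ ?_) y hy
  · exact le_ciInf fun w => hp.2 w w.2
  · exact ciInf_le ⟨0, by rintro _ ⟨w, rfl⟩; exact norm_nonneg _⟩ (⟨_, hp.1⟩ : K)

/-- Adding the obtuse-angle inequalities at the two projections gives firm nonexpansiveness;
Cauchy–Schwarz does the rest. -/
theorem norm_proj_sub_proj_le (hne : K.Nonempty) (hc : IsClosed K) (hK : Convex ℝ K) (z z' : E) :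
    ‖proj K z - proj K z'‖ ≤ ‖z - z'‖ := by
  have h1 := inner_sub_proj_nonpos hc hK z (isNearest_proj hne hc hK z').1
  have h2 := inner_sub_proj_nonpos hc hK z' (isNearest_proj hne hc hK z).1
  set p := proj K z
  set p' := proj K z'
  have h3 : ‖p - p'‖ ^ 2 ≤ inner ℝ (z - z') (p - p') := by
    have : inner ℝ (z - p) (p' - p) + inner ℝ (z' - p') (p - p') =
        ‖p - p'‖ ^ 2 - inner ℝ (z - z') (p - p') := by
      rw [← real_inner_self_eq_norm_sq]
      simp only [inner_sub_left, inner_sub_right]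
      ring
    linarith
  have h4 := real_inner_le_norm (z - z') (p - p')
  rcases (norm_nonneg (p - p')).eq_or_lt with h | h
  · rw [← h]
    exact norm_nonneg _
  · exact le_of_mul_le_mul_right (by nlinarith) h

theorem norm_proj_sub_le (hc : IsClosed K) (hK : Convex ℝ K) (z : E) {y : E} (hy : y ∈ K) :
    ‖proj K z - y‖ ≤ ‖z - y‖ := by
  have hpy : proj K y = y := by
    have := (isNearest_proj ⟨y, hy⟩ hc hK y).2 y hy
    rw [sub_self, norm_zero, norm_le_zero_iff, sub_eq_zero] at this
    exact this.symm
  have := norm_proj_sub_proj_le ⟨y, hy⟩ hc hK z y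
  rwa [hpy] at this

theorem continuous_proj (hne : K.Nonempty) (hc : IsClosed K) (hK : Convex ℝ K) :
    Continuous (proj K) :=
  (LipschitzWith.of_dist_le_mul (K := 1) fun z z' => by
    simpa [dist_eq_norm] using norm_proj_sub_proj_le hne hc hK z z').continuous

end

/-! ### One round of gradient play -/

/-- The profile after one round with step size `c` from the profile `x` and directions `v`. -/
noncomputable def roundMap (X : ∀ i : Fin n, Set (Strat (d i))) (F : Fin n → Joint d → ℝ) (δ c : ℝ)
    (x v : Joint d) : Joint d :=
  WithLp.toLp 2 fun i => proj ((1 - δ) • X i) (x i - c • gradEst F δ x v i)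

section
variable {X : ∀ i : Fin n, Set (Strat (d i))} {f F : Fin n → Joint d → ℝ} {α β L r R : ℝ}

theorem StandingAssumptions.shrunk_convex (hg : StandingAssumptions X f α β L r R) (δ : ℝ)
    (i : Fin n) : Convex ℝ ((1 - δ) • X i) := (hg.convex i).smul _

theorem StandingAssumptions.shrunk_closed (hg : StandingAssumptions X f α β L r R) (δ : ℝ)
    (i : Fin n) : IsClosed ((1 - δ) • X i) := by
  by_cases h : 1 - δ = 0
  · rw [h, Set.zero_smul_set ⟨0, hg.zero_mem i⟩]
    exact isClosed_singleton
  · exact (hg.closed i).smul_of_ne_zero h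

theorem StandingAssumptions.shrunk_nonempty (hg : StandingAssumptions X f α β L r R) (δ : ℝ)
    (i : Fin n) : ((1 - δ) • X i).Nonempty := Set.Nonempty.smul_set ⟨0, hg.zero_mem i⟩

theorem exists_smul_eq_of_forall_mem_smul {x : Joint d} {c : ℝ} (hx : ∀ i, x i ∈ c • X i) :
    ∃ z ∈ jointSet X, x = c • z := by
  choose z hz hzx using hx
  refine ⟨WithLp.toLp 2 z, hz, ?_⟩
  ext i : 1
  exact (hzx i).symm

theorem StandingAssumptions.shrunk_subset (hg : StandingAssumptions X f α β L r R) {δ : ℝ}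
    (hδ0 : 0 ≤ δ) (hδ1 : δ ≤ 1) {x : Joint d} (hx : ∀ i, x i ∈ (1 - δ) • X i) :
    x ∈ jointSet X := by
  obtain ⟨z, hz, rfl⟩ := exists_smul_eq_of_forall_mem_smul hx
  exact hg.smul_mem hz (by linarith) (by linarith)

theorem add_smul_mem_of_feasible {δ : ℝ}
    (hfeas : ∀ i, ∀ u ∈ X i, ∀ s : Strat (d i), ‖s‖ = 1 → (1 - δ) • u + δ • s ∈ X i)
    {x w : Joint d} (hx : ∀ i, x i ∈ (1 - δ) • X i) (hw : ∀ i, ‖w i‖ = 1) :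
    x + δ • w ∈ jointSet X := by
  intro i
  obtain ⟨u, hu, hux⟩ := hx i
  have := hfeas i u hu (w i) (hw i)
  rw [PiLp.add_apply, PiLp.smul_apply, ← hux]
  exact this

theorem StandingAssumptions.roundMap_mem (hg : StandingAssumptions X f α β L r R)
    (δ c : ℝ) (x v : Joint d) (i : Fin n) :
    roundMap X F δ c x v i ∈ (1 - δ) • X i :=
  (isNearest_proj (hg.shrunk_nonempty δ i) (hg.shrunk_closed δ i) (hg.shrunk_convex δ i) _).1

/-- The bias of the one-point estimate of the partial gradient. -/
theorem StandingAssumptions.abs_integral_inner_gradEst_sub_le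
    (hg : StandingAssumptions X f α β L r R) (hd : ∀ i, d i ≠ 0) {δ : ℝ} (hδ0 : 0 < δ)
    (hδ1 : δ ≤ 1)
    (hfeas : ∀ i, ∀ u ∈ X i, ∀ s : Strat (d i), ‖s‖ = 1 → (1 - δ) • u + δ • s ∈ X i)
    (hF : ∀ i, Measurable (F i)) (hFf : ∀ i, ∀ z ∈ jointSet X, F i z = f i z)
    {x : Joint d} (hx : ∀ i, x i ∈ (1 - δ) • X i) (i : Fin n) (e : Strat (d i)) :
    |∫ w, inner ℝ (gradEst F δ x (WithLp.toLp 2 w) i) e ∂(sphereProd d) -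
      inner ℝ (partialGrad X f i x) e| ≤ β * (√(n : ℝ) * δ) * ‖e‖ := by
  have hxX := hg.shrunk_subset hδ0.le hδ1 hx
  have hdpos : (0 : ℝ) < d i := by exact_mod_cast Nat.pos_of_ne_zero (hd i)
  have main : ∀ u : Strat (d i), ‖u‖ = 1 →
      |∫ w, inner ℝ (gradEst F δ x (WithLp.toLp 2 w) i) u ∂(sphereProd d) -
      inner ℝ (partialGrad X f i x) u| ≤ β * (√(n : ℝ) * δ) := by
    intro u hu
    have hmem : ∀ w : ∀ i, Strat (d i), (∀ i, ‖w i‖ = 1) →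
        x + δ • (WithLp.toLp 2 w : Joint d) ∈ jointSet X := fun w hw =>
      add_smul_mem_of_feasible hfeas hx hw
    have hmeas : Measurable fun w : ∀ i, Strat (d i) => F i (x + δ • WithLp.toLp 2 w) :=
      (hF i).comp (by fun_prop)
    have key := abs_integral_mul_inner_sub_le hd i hu hmeas (B := √(Fstar X f))
      (fun w hw => by
        rw [hFf i _ (hmem w hw)]
        exact Real.le_sqrt_of_sq_le (hg.sq_abs_cost_le i (hmem w hw)))
      (c := δ * inner ℝ (partialGrad X f i x) u) (M := δ * (β * (√(n : ℝ) * δ)))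
      (fun w hw => by
        have hw' : ∀ j, ‖reflectBlock i u w j‖ = 1 := fun j => by
          rw [norm_reflectBlock_apply, hw]
        have hz := hmem w hw
        have hz' := hmem _ hw'
        rw [hFf i _ hz, hFf i _ hz']
        set z : Joint d := x + δ • WithLp.toLp 2 w with hzdef
        set z' : Joint d := x + δ • WithLp.toLp 2 (reflectBlock i u w) with hzdef'
        have hdist : ∀ j, ‖z j - x j‖ ≤ δ := fun j => by
          simp [hzdef, norm_smul, hw, abs_of_pos hδ0]
        have hdist' : ∀ j, ‖z' j - x j‖ ≤ δ := fun j => by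
          simp [hzdef', norm_smul, hw', abs_of_pos hδ0]
        -- Both queries are deviations of the single profile `z` in block `i`, so the own-strategy
        -- expansion compares them directly.
        have e1 : deviate z i (z i) = z := by simp [deviate]
        have e2 : deviate z i (z' i) = z' := by
          ext j : 1
          rcases eq_or_ne j i with rfl | h
          · rw [deviate_apply_self]
          · rw [deviate_apply_of_ne _ h]
            simp [hzdef, hzdef', reflectBlock, h]
        have e3 : z i - z' i = (δ * (2 * inner ℝ (w i) u)) • u := by
          simp only [hzdef, hzdef', PiLp.add_apply, PiLp.smul_apply, reflectBlock_apply_self i hu]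
          rw [smul_sub, smul_smul]
          abel
        have := hg.abs_cost_sub_le hxX hz hδ0.le hdist (hz i) (hz' i) (hdist i) (hdist' i)
        rw [e1, e2, e3, real_inner_smul_right, norm_smul, hu, Real.norm_eq_abs, abs_mul,
          abs_of_pos hδ0] at this
        refine le_trans (le_of_eq ?_) (this.trans (le_of_eq ?_))
        · congr 1
          ring
        · ring)
    have hint : ∫ w, inner ℝ (gradEst F δ x (WithLp.toLp 2 w) i) u ∂(sphereProd d) =
        d i / δ * ∫ w, F i (x + δ • WithLp.toLp 2 w) * inner ℝ (w i) u ∂(sphereProd d) := by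
      rw [← integral_const_mul]
      refine integral_congr_ae (Filter.Eventually.of_forall fun w => ?_)
      simp only [gradEst, real_inner_smul_left]
      ring
    rw [hint]
    set I := ∫ w, F i (x + δ • WithLp.toLp 2 w) * inner ℝ (w i) u ∂(sphereProd d)
    have e4 : d i / δ * I - inner ℝ (partialGrad X f i x) u =
        d i / δ * (I - δ * inner ℝ (partialGrad X f i x) u / d i) := by
      field_simp
    rw [e4, abs_mul, abs_of_pos (by positivity)]
    calc _ ≤ d i / δ * (δ * (β * (√(n : ℝ) * δ)) / d i) := by gcongr
      _ = _ := by field_simp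
  rcases eq_or_ne e 0 with rfl | he
  · simp
  have h := main (‖e‖⁻¹ • e) (norm_smul_inv_norm (𝕜 := ℝ) he)
  simp_rw [real_inner_smul_right, integral_const_mul] at h
  rw [← mul_sub, abs_mul, abs_of_pos (by positivity)] at h
  rw [mul_comm, ← inv_mul_le_iff₀ (by positivity)]
  exact h

end

/-! ### Drift, second moment and one-round progress -/

section
variable {X : ∀ i : Fin n, Set (Strat (d i))} {f F : Fin n → Joint d → ℝ} {α β L r R : ℝ}

/-- The gradient points away from the shrunk equilibrium, up to an error linear in the distance. -/
theorem StandingAssumptions.inner_gradMap_sub_shrunk_nash_ge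
    (hg : StandingAssumptions X f α β L r R) {δ : ℝ} (hδ0 : 0 ≤ δ) (hδ1 : δ ≤ 1)
    {xs : Joint d} (hxs : IsNash X f xs) {x : Joint d} (hx : ∀ i, x i ∈ (1 - δ) • X i) :
    α * ‖x - (1 - δ) • xs‖ ^ 2 - δ * (β * √(n : ℝ) * R) * ‖x - (1 - δ) • xs‖ ≤
      inner ℝ (gradMap X f x) (x - (1 - δ) • xs) := by
  have hxX := hg.shrunk_subset hδ0 hδ1 hx
  have hxsX : xs ∈ jointSet X := fun i => (hxs i).1
  have hyX : (1 - δ) • xs ∈ jointSet X := hg.smul_mem hxsX (by linarith) (by linarith)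
  set y := (1 - δ) • xs with hy
  have h1 := hg.strongly_monotone x hxX y hyX
  -- Since `x = (1 - δ) • z` with `z` feasible, `x - y` is `(1 - δ) • (z - xs)`, and the variational
  -- inequality applies to `z`.
  have h2 : 0 ≤ inner ℝ (gradMap X f xs) (x - y) := by
    obtain ⟨z, hz, rfl⟩ := exists_smul_eq_of_forall_mem_smul hx
    rw [hy, ← smul_sub, real_inner_smul_right]
    exact mul_nonneg (by linarith) (hg.inner_gradMap_nash_nonneg hxs hz)
  have h3 : -(δ * (β * √(n : ℝ) * R) * ‖x - y‖) ≤
      inner ℝ (gradMap X f y - gradMap X f xs) (x - y) := by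
    have ha := (abs_le.1 (abs_real_inner_le_norm (gradMap X f y - gradMap X f xs) (x - y))).1
    have hb := hg.norm_gradMap_sub_le hyX hxsX
    have hyx : ‖y - xs‖ ≤ δ * R := by
      have : y - xs = -(δ • xs) := by
        rw [hy, sub_smul, one_smul]
        abel
      rw [this, norm_neg, norm_smul, Real.norm_of_nonneg hδ0]
      exact mul_le_mul_of_nonneg_left (hg.norm_le hxsX) hδ0
    have hc : ‖gradMap X f y - gradMap X f xs‖ ≤ δ * (β * √(n : ℝ) * R) := by
      calc _ ≤ √(n : ℝ) * (β * ‖y - xs‖) := hb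
        _ ≤ √(n : ℝ) * (β * (δ * R)) := by
            have := hg.β_nonneg
            gcongr
        _ = _ := by ring
    have := mul_le_mul_of_nonneg_right hc (norm_nonneg (x - y))
    linarith
  simp only [inner_sub_left] at h1 h3
  linarith

/-- The bias adds `β √n δ ‖D i‖` per block, hence `β n δ ‖D‖` by Cauchy–Schwarz. Together with the
cost of shrinking it is absorbed by Young's inequality, at the price of half the strong
monotonicity. -/
theorem StandingAssumptions.sum_integral_inner_gradEst_ge
    (hg : StandingAssumptions X f α β L r R) (hd : ∀ i, d i ≠ 0) {δ : ℝ} (hδ0 : 0 < δ)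
    (hδ1 : δ ≤ 1)
    (hfeas : ∀ i, ∀ u ∈ X i, ∀ s : Strat (d i), ‖s‖ = 1 → (1 - δ) • u + δ • s ∈ X i)
    (hF : ∀ i, Measurable (F i)) (hFf : ∀ i, ∀ z ∈ jointSet X, F i z = f i z)
    {xs : Joint d} (hxs : IsNash X f xs) {x : Joint d} (hx : ∀ i, x i ∈ (1 - δ) • X i) :
    α / 2 * ‖x - (1 - δ) • xs‖ ^ 2 - (δ * (β * n + β * √(n : ℝ) * R)) ^ 2 / (2 * α) ≤
      ∑ i, ∫ w, inner ℝ (gradEst F δ x (WithLp.toLp 2 w) i) ((x - (1 - δ) • xs) i)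
        ∂(sphereProd d) := by
  set D := x - (1 - δ) • xs with hD
  have h1 := hg.inner_gradMap_sub_shrunk_nash_ge hδ0.le hδ1 hxs hx
  rw [← hD] at h1
  have h2 : inner ℝ (gradMap X f x) D - β * n * δ * ‖D‖ ≤
      ∑ i, ∫ w, inner ℝ (gradEst F δ x (WithLp.toLp 2 w) i) (D i) ∂(sphereProd d) := by
    have hb : ∀ i, inner ℝ (partialGrad X f i x) (D i) - β * (√(n : ℝ) * δ) * ‖D i‖ ≤
        ∫ w, inner ℝ (gradEst F δ x (WithLp.toLp 2 w) i) (D i) ∂(sphereProd d) := fun i => by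
      have := (abs_le.1 (hg.abs_integral_inner_gradEst_sub_le hd hδ0 hδ1 hfeas hF hFf hx i (D i))).1
      linarith
    refine le_trans ?_ (Finset.sum_le_sum fun i _ => hb i)
    rw [Finset.sum_sub_distrib, ← Finset.mul_sum, PiLp.inner_apply]
    refine sub_le_sub_left ?_ _
    calc _ ≤ β * (√(n : ℝ) * δ) * (√(n : ℝ) * ‖D‖) := by
          have := hg.β_nonneg
          have := sum_norm_le_sqrt_mul_norm D
          gcongr
      _ = β * (√(n : ℝ) * √(n : ℝ)) * δ * ‖D‖ := by ring
      _ = _ := by rw [Real.mul_self_sqrt (Nat.cast_nonneg n)]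
  have hα := hg.α_pos
  set e := δ * (β * n + β * √(n : ℝ) * R) with he
  have h3 : e * ‖D‖ ≤ α / 2 * ‖D‖ ^ 2 + e ^ 2 / (2 * α) := by
    have : α / 2 * ‖D‖ ^ 2 + e ^ 2 / (2 * α) - e * ‖D‖ = (α * ‖D‖ - e) ^ 2 / (2 * α) := by
      field_simp
      ring
    have h0 : 0 ≤ (α * ‖D‖ - e) ^ 2 / (2 * α) := by positivity
    linarith
  have h4 : e * ‖D‖ = β * n * δ * ‖D‖ + δ * (β * √(n : ℝ) * R) * ‖D‖ := by
    rw [he]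
    ring
  linarith

theorem StandingAssumptions.measurable_roundMap (hg : StandingAssumptions X f α β L r R)
    (hF : ∀ i, Measurable (F i)) (δ c : ℝ) :
    Measurable fun p : Joint d × Joint d => roundMap X F δ c p.1 p.2 := by
  refine (WithLp.measurable_toLp 2 _).comp (measurable_pi_lambda _ fun i => ?_)
  refine (continuous_proj (hg.shrunk_nonempty δ i) (hg.shrunk_closed δ i)
    (hg.shrunk_convex δ i)).measurable.comp ?_
  have h1 : Measurable fun p : Joint d × Joint d => F i (p.1 + δ • p.2) := (hF i).comp (by fun_prop)
  have h2 : Measurable fun p : Joint d × Joint d => p.1 i := by fun_prop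
  have h3 : Measurable fun p : Joint d × Joint d => p.2 i := by fun_prop
  exact h2.sub (((h1.const_mul ((d i : ℝ) / δ)).smul h3).const_smul c)

theorem StandingAssumptions.sum_norm_sq_gradEst_le (hg : StandingAssumptions X f α β L r R)
    {δ : ℝ}
    (hfeas : ∀ i, ∀ u ∈ X i, ∀ s : Strat (d i), ‖s‖ = 1 → (1 - δ) • u + δ • s ∈ X i)
    (hFf : ∀ i, ∀ z ∈ jointSet X, F i z = f i z) {x : Joint d} (hx : ∀ i, x i ∈ (1 - δ) • X i)
    {w : Joint d} (hw : ∀ i, ‖w i‖ = 1) :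
    ∑ i, ‖gradEst F δ x w i‖ ^ 2 ≤ (∑ i, (d i : ℝ)) ^ 2 * Fstar X f / δ ^ 2 := by
  have hz := add_smul_mem_of_feasible hfeas hx hw
  calc _ ≤ ∑ i, (d i : ℝ) ^ 2 * (Fstar X f / δ ^ 2) := by
        refine Finset.sum_le_sum fun i _ => ?_
        have h1 := hg.sq_abs_cost_le i hz
        rw [gradEst, norm_smul, hw, mul_one, hFf i _ hz, Real.norm_eq_abs, sq_abs, mul_pow, div_pow]
        rw [sq_abs] at h1
        calc _ = (d i : ℝ) ^ 2 * (f i (x + δ • w) ^ 2 / δ ^ 2) := by ring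
          _ ≤ _ := by gcongr
    _ ≤ (∑ i, (d i : ℝ)) ^ 2 * (Fstar X f / δ ^ 2) := by
        rw [← Finset.sum_mul]
        have := Fstar_nonneg X f
        gcongr
        exact Finset.sum_sq_le_sq_sum_of_nonneg fun i _ => Nat.cast_nonneg _
    _ = _ := by ring

/-- Expected progress of one round towards the shrunk equilibrium. -/
theorem StandingAssumptions.integral_norm_sq_roundMap_sub_le
    (hg : StandingAssumptions X f α β L r R) (hd : ∀ i, d i ≠ 0) {δ : ℝ} (hδ0 : 0 < δ)
    (hδ1 : δ < 1)
    (hfeas : ∀ i, ∀ u ∈ X i, ∀ s : Strat (d i), ‖s‖ = 1 → (1 - δ) • u + δ • s ∈ X i)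
    (hF : ∀ i, Measurable (F i)) (hFf : ∀ i, ∀ z ∈ jointSet X, F i z = f i z)
    {xs : Joint d} (hxs : IsNash X f xs) {c : ℝ} (hc : 0 ≤ c)
    {x : Joint d} (hx : ∀ i, x i ∈ (1 - δ) • X i) :
    ∫ w, ‖roundMap X F δ c x (WithLp.toLp 2 w) - (1 - δ) • xs‖ ^ 2 ∂(sphereProd d) ≤
      (1 - α * c) * ‖x - (1 - δ) • xs‖ ^ 2 +
        c * ((δ * (β * n + β * √(n : ℝ) * R)) ^ 2 / α) +
        c ^ 2 * ((∑ i, (d i : ℝ)) ^ 2 * Fstar X f / δ ^ 2) := by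
  have := sphereProd_isProbabilityMeasure hd
  have key := hg.sum_integral_inner_gradEst_ge hd hδ0 hδ1.le hfeas hF hFf hxs hx
  set G := (∑ i, (d i : ℝ)) ^ 2 * Fstar X f / δ ^ 2
  set D := x - (1 - δ) • xs with hD
  have hGi : ∀ w : ∀ i, Strat (d i), (∀ i, ‖w i‖ = 1) →
      ∑ i, ‖gradEst F δ x (WithLp.toLp 2 w) i‖ ^ 2 ≤ G := fun w hw =>
    hg.sum_norm_sq_gradEst_le hfeas hFf hx hw
  have hG0 : 0 ≤ G := by
    have := Fstar_nonneg X f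
    positivity
  have hest : ∀ i, Measurable fun w : ∀ i, Strat (d i) => gradEst F δ x (WithLp.toLp 2 w) i :=
    fun i => by
      have h1 : Measurable fun w : ∀ i, Strat (d i) => F i (x + δ • WithLp.toLp 2 w) :=
        (hF i).comp (by fun_prop)
      exact (h1.const_mul ((d i : ℝ) / δ)).smul (measurable_pi_apply i)
  have hint : ∀ i, Integrable
      (fun w => inner ℝ (gradEst F δ x (WithLp.toLp 2 w) i) (D i)) (sphereProd d) := fun i => by
    have := hest i
    refine integrable_sphereProd_of_bound hd (by fun_prop) (B := √G * ‖D i‖) fun w hw => ?_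
    refine (abs_real_inner_le_norm _ _).trans ?_
    gcongr
    refine Real.le_sqrt_of_sq_le (le_trans ?_ (hGi w hw))
    exact Finset.single_le_sum (f := fun i => ‖gradEst F δ x (WithLp.toLp 2 w) i‖ ^ 2)
      (fun i _ => by positivity) (Finset.mem_univ i)
  -- The shrunk equilibrium is fixed by the projection, so projecting does not increase the distance
  -- to it; expand the unprojected step.
  have hpt : ∀ w : ∀ i, Strat (d i), (∀ i, ‖w i‖ = 1) →
      ‖roundMap X F δ c x (WithLp.toLp 2 w) - (1 - δ) • xs‖ ^ 2 ≤
      ‖D‖ ^ 2 - 2 * c * ∑ i, inner ℝ (gradEst F δ x (WithLp.toLp 2 w) i) (D i) + c ^ 2 * G := by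
    intro w hw
    rw [PiLp.norm_sq_eq_of_L2, PiLp.norm_sq_eq_of_L2]
    calc _ ≤ ∑ i, ‖D i - c • gradEst F δ x (WithLp.toLp 2 w) i‖ ^ 2 := by
          refine Finset.sum_le_sum fun i _ => ?_
          have hy : ((1 - δ) • xs) i ∈ (1 - δ) • X i := ⟨xs i, (hxs i).1, rfl⟩
          have := norm_proj_sub_le (hg.shrunk_closed δ i) (hg.shrunk_convex δ i)
            (x i - c • gradEst F δ x (WithLp.toLp 2 w) i) hy
          have e : D i - c • gradEst F δ x (WithLp.toLp 2 w) i =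
              x i - c • gradEst F δ x (WithLp.toLp 2 w) i - ((1 - δ) • xs) i := by
            rw [hD, PiLp.sub_apply]
            abel
          rw [e]
          exact pow_le_pow_left₀ (norm_nonneg _) this 2
      _ = ∑ i, ‖D i‖ ^ 2 - 2 * c * ∑ i, inner ℝ (gradEst F δ x (WithLp.toLp 2 w) i) (D i) +
          c ^ 2 * ∑ i, ‖gradEst F δ x (WithLp.toLp 2 w) i‖ ^ 2 := by
          rw [Finset.mul_sum, Finset.mul_sum, ← Finset.sum_sub_distrib, ← Finset.sum_add_distrib]
          refine Finset.sum_congr rfl fun i _ => ?_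
          rw [norm_sub_sq_real, real_inner_smul_right, norm_smul, mul_pow, Real.norm_eq_abs, sq_abs,
            real_inner_comm]
          ring
      _ ≤ _ := by
          have := mul_le_mul_of_nonneg_left (hGi w hw) (sq_nonneg c)
          linarith
  have hsum : Integrable (fun w => ∑ i, inner ℝ (gradEst F δ x (WithLp.toLp 2 w) i) (D i))
      (sphereProd d) := integrable_finsetSum _ fun i _ => hint i
  have hrhs : Integrable (fun w => ‖D‖ ^ 2 -
      2 * c * ∑ i, inner ℝ (gradEst F δ x (WithLp.toLp 2 w) i) (D i) + c ^ 2 * G)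
      (sphereProd d) :=
    ((integrable_const _).sub (hsum.const_mul _)).add (integrable_const _)
  calc _ ≤ ∫ w, (‖D‖ ^ 2 -
        2 * c * ∑ i, inner ℝ (gradEst F δ x (WithLp.toLp 2 w) i) (D i) + c ^ 2 * G)
        ∂(sphereProd d) := by
        refine integral_mono_of_nonneg (Filter.Eventually.of_forall fun w => by positivity) hrhs ?_
        filter_upwards [sphereProd_ae_norm_eq_one hd] with w hw using hpt w hw
    _ = ‖D‖ ^ 2 - 2 * c * ∑ i, ∫ w, inner ℝ (gradEst F δ x (WithLp.toLp 2 w) i) (D i)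
        ∂(sphereProd d) + c ^ 2 * G := by
        have hsub : Integrable (fun w => ‖D‖ ^ 2 -
            2 * c * ∑ i, inner ℝ (gradEst F δ x (WithLp.toLp 2 w) i) (D i)) (sphereProd d) :=
          (integrable_const _).sub (hsum.const_mul _)
        rw [integral_add hsub (integrable_const _),
          integral_sub (integrable_const _) (hsum.const_mul _), integral_const_mul,
          integral_finsetSum _ fun i _ => hint i]
        simp
    _ ≤ _ := by
        have h5 := mul_le_mul_of_nonneg_left key (by linarith : 0 ≤ 2 * c)
        have e5 : 2 * c * (α / 2 * ‖D‖ ^ 2 - (δ * (β * n + β * √(n : ℝ) * R)) ^ 2 / (2 * α)) =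
            α * c * ‖D‖ ^ 2 - c * ((δ * (β * n + β * √(n : ℝ) * R)) ^ 2 / α) := by
          have := hg.α_pos
          field_simp
        linarith

end

/-! ### The stochastic process -/

/-- Fubini on the product law plays the role of conditioning on `Y`. -/
theorem integral_comp_prodMk_of_map_eq_prod {Ω A B : Type*} [MeasurableSpace Ω] [MeasurableSpace A]
    [MeasurableSpace B] {P : Measure Ω} [IsProbabilityMeasure P] {ν : Measure B}
    [IsProbabilityMeasure ν] {Y : Ω → A} {W : Ω → B} (hY : Measurable Y) (hW : Measurable W)
    (hmap : P.map (fun ω => (Y ω, W ω)) = (P.map Y).prod ν) {h : A × B → ℝ} (hh : Measurable h)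
    (hint : Integrable (fun ω => h (Y ω, W ω)) P) :
    Integrable (fun ω => ∫ w, h (Y ω, w) ∂ν) P ∧
      ∫ ω, h (Y ω, W ω) ∂P = ∫ ω, ∫ w, h (Y ω, w) ∂ν ∂P := by
  have hYW : Measurable fun ω => (Y ω, W ω) := hY.prodMk hW
  have : IsProbabilityMeasure (P.map Y) := Measure.isProbabilityMeasure_map hY.aemeasurable
  have h1 : Integrable h ((P.map Y).prod ν) := by
    rw [← hmap]
    exact (integrable_map_measure hh.aestronglyMeasurable hYW.aemeasurable).2 hint
  have h2 := h1.integral_prod_left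
  refine ⟨(integrable_map_measure h2.aestronglyMeasurable hY.aemeasurable).1 h2, ?_⟩
  rw [← integral_map hYW.aemeasurable hh.aestronglyMeasurable, hmap, integral_prod _ h1,
    integral_map hY.aemeasurable h2.aestronglyMeasurable]

section
variable {X : ∀ i : Fin n, Set (Strat (d i))} {f F : Fin n → Joint d → ℝ} {α β L r R : ℝ}

theorem dfo_succ (X : ∀ i : Fin n, Set (Strat (d i))) (f : Fin n → Joint d → ℝ) (η : ℕ → ℝ) (δ : ℝ)
    (x₀ : Joint d) (v : ℕ → Joint d) (t : ℕ) :
    dfo X f η δ x₀ v (t + 1) = roundMap X f δ (η t) (dfo X f η δ x₀ v t) (v t) := rfl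

theorem StandingAssumptions.dfo_mem (hg : StandingAssumptions X f α β L r R) (δ : ℝ)
    (η : ℕ → ℝ) {x₀ : Joint d} (hx₀ : ∀ i, x₀ i ∈ (1 - δ) • X i) (v : ℕ → Joint d) (t : ℕ) (i : Fin n) :
    dfo X F η δ x₀ v t i ∈ (1 - δ) • X i := by
  cases t with
  | zero => exact hx₀ i
  | succ t => exact hg.roundMap_mem δ _ _ _ i

/-- Adaptedness: this is what makes the iterate independent of the current directions. -/
theorem dfo_congr_of_lt {η : ℕ → ℝ} {δ : ℝ} {x₀ : Joint d} {v v' : ℕ → Joint d} {t : ℕ}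
    (h : ∀ s < t, v s = v' s) : dfo X F η δ x₀ v t = dfo X F η δ x₀ v' t := by
  induction t with
  | zero => rfl
  | succ t ih => rw [dfo_succ, dfo_succ, ih fun s hs => h s (by omega), h t (by omega)]

/-- With unit directions every query stays in `jointSet X`, so only the costs there matter. It
allows `f`, Borel only on that set, to be replaced by a globally measurable `F`. -/
theorem StandingAssumptions.dfo_congr_cost (hg : StandingAssumptions X f α β L r R) {δ : ℝ}
    (hfeas : ∀ i, ∀ u ∈ X i, ∀ s : Strat (d i), ‖s‖ = 1 → (1 - δ) • u + δ • s ∈ X i)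
    (hFf : ∀ i, ∀ z ∈ jointSet X, F i z = f i z) {η : ℕ → ℝ} {x₀ : Joint d}
    (hx₀ : ∀ i, x₀ i ∈ (1 - δ) • X i) {v : ℕ → Joint d} (hv : ∀ s i, ‖v s i‖ = 1) (t : ℕ) :
    dfo X F η δ x₀ v t = dfo X f η δ x₀ v t := by
  induction t with
  | zero => rfl
  | succ t ih =>
    rw [dfo_succ, dfo_succ, ih]
    have hz := add_smul_mem_of_feasible hfeas (hg.dfo_mem (F := f) δ η hx₀ v t) (hv t)
    simp only [roundMap, gradEst]
    congr 1
    funext i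
    rw [hFf i _ hz]

theorem StandingAssumptions.measurable_dfo (hg : StandingAssumptions X f α β L r R)
    (hF : ∀ i, Measurable (F i)) (δ : ℝ) (η : ℕ → ℝ) (x₀ : Joint d) (t : ℕ) :
    Measurable fun v : ℕ → Joint d => dfo X F η δ x₀ v t := by
  induction t with
  | zero => exact measurable_const
  | succ t ih =>
    simp only [dfo_succ]
    exact (hg.measurable_roundMap hF δ (η t)).comp
      (f := fun v : ℕ → Joint d => (dfo X F η δ x₀ v t, v t)) (ih.prodMk (measurable_pi_apply t))

variable {Ω : Type*} {v : ℕ → (i : Fin n) → Ω → Strat (d i)}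

/-- The iterate `x^t` as a function of the sample point. -/
noncomputable def iterate (X : ∀ i : Fin n, Set (Strat (d i))) (F : Fin n → Joint d → ℝ) (η : ℕ → ℝ)
    (δ : ℝ) (x₀ : Joint d) (v : ℕ → (i : Fin n) → Ω → Strat (d i)) (t : ℕ) (ω : Ω) : Joint d :=
  dfo X F η δ x₀ (fun s => WithLp.toLp 2 fun i => v s i ω) t

theorem StandingAssumptions.norm_iterate_le (hg : StandingAssumptions X f α β L r R) (δ : ℝ)
    (η : ℕ → ℝ) {x₀ : Joint d} (hx₀ : ∀ i, x₀ i ∈ (1 - δ) • X i) (t : ℕ) (ω : Ω) :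
    ‖iterate X F η δ x₀ v t ω‖ ≤ |1 - δ| * R := by
  obtain ⟨z, hz, hzx⟩ := exists_smul_eq_of_forall_mem_smul
    (hg.dfo_mem (F := F) δ η hx₀ (fun s => WithLp.toLp 2 fun i => v s i ω) t)
  rw [iterate, hzx, norm_smul, Real.norm_eq_abs]
  exact mul_le_mul_of_nonneg_left (hg.norm_le hz) (abs_nonneg _)

variable [MeasurableSpace Ω] {P : Measure Ω} [IsProbabilityMeasure P]

theorem StandingAssumptions.measurable_iterate (hg : StandingAssumptions X f α β L r R)
    (hF : ∀ i, Measurable (F i)) (δ : ℝ) (η : ℕ → ℝ) (x₀ : Joint d)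
    (hv : ∀ s i, Measurable (v s i)) (t : ℕ) : Measurable (iterate X F η δ x₀ v t) :=
  (hg.measurable_dfo hF δ η x₀ t).comp (measurable_pi_lambda _ fun s =>
    (WithLp.measurable_toLp 2 _).comp (measurable_pi_lambda _ fun i => hv s i))

/-- The current iterate is independent of the current directions. -/
theorem StandingAssumptions.map_iterate_prodMk (hg : StandingAssumptions X f α β L r R)
    (hF : ∀ i, Measurable (F i)) (δ : ℝ) (η : ℕ → ℝ) (x₀ : Joint d)
    (hv : ∀ s i, Measurable (v s i)) (hlaw : ∀ s i, P.map (v s i) = uniformSphere (d i))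
    (hindep : iIndepFun (fun p : ℕ × Fin n => v p.1 p.2) P) (t : ℕ) :
    P.map (fun ω => (iterate X F η δ x₀ v t ω, fun i => v t i ω)) =
      (P.map (iterate X F η δ x₀ v t)).prod (sphereProd d) := by
  classical
  have hw : Measurable fun ω i => v t i ω := measurable_pi_lambda _ fun i => hv t i
  have hmap : P.map (fun ω i => v t i ω) = sphereProd d := by
    have h1 : iIndepFun (fun i => v t i) P :=
      hindep.precomp (g := fun i : Fin n => (t, i)) (Prod.mk_right_injective t)
    rw [(iIndepFun_iff_map_fun_eq_pi_map fun i => (hv t i).aemeasurable).1 h1]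
    simp_rw [hlaw]
    rfl
  have hind : IndepFun (iterate X F η δ x₀ v t) (fun ω i => v t i ω) P := by
    let S : Finset (ℕ × Fin n) := Finset.range t ×ˢ Finset.univ
    let T : Finset (ℕ × Fin n) := {t} ×ˢ Finset.univ
    have hST : Disjoint S T := by
      rw [Finset.disjoint_left]
      rintro ⟨s, i⟩ hs ht
      simp only [S, T, Finset.mem_product, Finset.mem_range, Finset.mem_singleton] at hs ht
      omega
    have h0 := hindep.indepFun_finset S T hST fun p => hv p.1 p.2
    -- Rebuild the iterate from the finitely many past directions, padding the remaining ones with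
    -- zeros, which it does not see.
    let φ : (∀ p : S, Strat (d p.1.2)) → Joint d := fun u =>
      dfo X F η δ x₀ (fun s => WithLp.toLp 2 fun i =>
        if h : (s, i) ∈ S then u ⟨(s, i), h⟩ else 0) t
    let ψ : (∀ p : T, Strat (d p.1.2)) → ∀ i, Strat (d i) := fun u i =>
      u ⟨(t, i), by simp [T]⟩
    have hφ : Measurable φ := by
      refine (hg.measurable_dfo hF δ η x₀ t).comp (measurable_pi_lambda _ fun s =>
        (WithLp.measurable_toLp 2 _).comp (measurable_pi_lambda _ fun i => ?_))
      by_cases h : (s, i) ∈ S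
      · simp only [h, dif_pos]
        exact measurable_pi_apply _
      · simp only [h, dif_neg, not_false_eq_true]
        exact measurable_const
    have hψ : Measurable ψ := measurable_pi_lambda _ fun i => measurable_pi_apply _
    have h2 := h0.comp hφ hψ
    have e1 : φ ∘ (fun ω (p : S) => v p.1.1 p.1.2 ω) = iterate X F η δ x₀ v t := by
      funext ω
      refine dfo_congr_of_lt fun s hs => ?_
      have h : ∀ i, (s, i) ∈ S := fun i => by simp [S, hs]
      simp [h]
    rwa [e1] at h2
  rw [← hmap]
  exact (indepFun_iff_map_prod_eq_prod_map_map
    (hg.measurable_iterate hF δ η x₀ hv t).aemeasurable hw.aemeasurable).1 hind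

theorem StandingAssumptions.integrable_norm_sq_iterate_sub
    (hg : StandingAssumptions X f α β L r R) (hF : ∀ i, Measurable (F i)) (δ : ℝ)
    (η : ℕ → ℝ) {x₀ : Joint d} (hx₀ : ∀ i, x₀ i ∈ (1 - δ) • X i)
    (hv : ∀ s i, Measurable (v s i)) (y : Joint d) (t : ℕ) :
    Integrable (fun ω => ‖iterate X F η δ x₀ v t ω - y‖ ^ 2) P := by
  have := hg.measurable_iterate hF δ η x₀ hv t
  refine Integrable.of_bound (Measurable.aestronglyMeasurable (by fun_prop)) ((|1 - δ| * R + ‖y‖) ^ 2)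
    (Filter.Eventually.of_forall fun ω => ?_)
  rw [norm_pow, norm_norm]
  have h1 := norm_sub_le (iterate X F η δ x₀ v t ω) y
  have h2 := hg.norm_iterate_le (F := F) (v := v) δ η hx₀ t ω
  gcongr
  linarith

theorem StandingAssumptions.integral_norm_sq_iterate_succ_le
    (hg : StandingAssumptions X f α β L r R) (hd : ∀ i, d i ≠ 0) {δ : ℝ} (hδ0 : 0 < δ)
    (hδ1 : δ < 1)
    (hfeas : ∀ i, ∀ u ∈ X i, ∀ s : Strat (d i), ‖s‖ = 1 → (1 - δ) • u + δ • s ∈ X i)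
    (hF : ∀ i, Measurable (F i)) (hFf : ∀ i, ∀ z ∈ jointSet X, F i z = f i z)
    {xs : Joint d} (hxs : IsNash X f xs) {η : ℕ → ℝ} {x₀ : Joint d}
    (hx₀ : ∀ i, x₀ i ∈ (1 - δ) • X i) (hv : ∀ s i, Measurable (v s i))
    (hlaw : ∀ s i, P.map (v s i) = uniformSphere (d i))
    (hindep : iIndepFun (fun p : ℕ × Fin n => v p.1 p.2) P) {t : ℕ} (hη : 0 ≤ η t) :
    ∫ ω, ‖iterate X F η δ x₀ v (t + 1) ω - (1 - δ) • xs‖ ^ 2 ∂P ≤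
      (1 - α * η t) * ∫ ω, ‖iterate X F η δ x₀ v t ω - (1 - δ) • xs‖ ^ 2 ∂P +
        η t * ((δ * (β * n + β * √(n : ℝ) * R)) ^ 2 / α) +
        η t ^ 2 * ((∑ i, (d i : ℝ)) ^ 2 * Fstar X f / δ ^ 2) := by
  have := sphereProd_isProbabilityMeasure hd
  have hYm := hg.measurable_iterate hF δ η x₀ hv t
  have hWm : Measurable fun ω i => v t i ω := measurable_pi_lambda _ fun i => hv t i
  have hmap := hg.map_iterate_prodMk hF δ η x₀ hv hlaw hindep t
  have hint := hg.integrable_norm_sq_iterate_sub (P := P) hF δ η hx₀ hv ((1 - δ) • xs) t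
  have hint' :=
    hg.integrable_norm_sq_iterate_sub (P := P) hF δ η hx₀ hv ((1 - δ) • xs) (t + 1)
  have hh : Measurable fun p : Joint d × (∀ i, Strat (d i)) =>
      ‖roundMap X F δ (η t) p.1 (WithLp.toLp 2 p.2) - (1 - δ) • xs‖ ^ 2 := by
    have h1 := (hg.measurable_roundMap hF δ (η t)).comp
      (f := fun p : Joint d × (∀ i, Strat (d i)) => (p.1, (WithLp.toLp 2 p.2 : Joint d)))
      (by fun_prop)
    exact ((h1.sub_const _).norm).pow_const 2
  obtain ⟨h1, h2⟩ := integral_comp_prodMk_of_map_eq_prod hYm hWm hmap hh hint'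
  calc _ = _ := h2
    _ ≤ ∫ ω, ((1 - α * η t) * ‖iterate X F η δ x₀ v t ω - (1 - δ) • xs‖ ^ 2 +
        (η t * ((δ * (β * n + β * √(n : ℝ) * R)) ^ 2 / α) +
        η t ^ 2 * ((∑ i, (d i : ℝ)) ^ 2 * Fstar X f / δ ^ 2))) ∂P := by
        refine integral_mono h1 ((hint.const_mul _).add (integrable_const _)) fun ω => ?_
        have := hg.integral_norm_sq_roundMap_sub_le hd hδ0 hδ1 hfeas hF hFf hxs hη
          (hg.dfo_mem (F := F) δ η hx₀ (fun s => WithLp.toLp 2 fun i => v s i ω) t)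
        rw [add_assoc] at this
        exact this
    _ = _ := by
        rw [integral_add (hint.const_mul _) (integrable_const _), integral_const_mul, add_assoc]
        simp

/-- Playing `x^t + δ v^t` instead of `x^t` costs exactly `δ² n` in mean square. -/
theorem StandingAssumptions.integral_norm_sq_played_sub
    (hg : StandingAssumptions X f α β L r R) (hd : ∀ i, d i ≠ 0) {δ : ℝ}
    (hF : ∀ i, Measurable (F i)) {η : ℕ → ℝ} {x₀ : Joint d}
    (hx₀ : ∀ i, x₀ i ∈ (1 - δ) • X i) (hv : ∀ s i, Measurable (v s i))
    (hlaw : ∀ s i, P.map (v s i) = uniformSphere (d i))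
    (hindep : iIndepFun (fun p : ℕ × Fin n => v p.1 p.2) P) (hnorm : ∀ᵐ ω ∂P, ∀ s i, ‖v s i ω‖ = 1)
    (y : Joint d) (t : ℕ) :
    Integrable (fun ω => ‖iterate X F η δ x₀ v t ω + δ • WithLp.toLp 2 (fun i => v t i ω) - y‖ ^ 2)
        P ∧
      ∫ ω, ‖iterate X F η δ x₀ v t ω + δ • WithLp.toLp 2 (fun i => v t i ω) - y‖ ^ 2 ∂P =
        ∫ ω, ‖iterate X F η δ x₀ v t ω - y‖ ^ 2 ∂P + δ ^ 2 * n := by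
  have := sphereProd_isProbabilityMeasure hd
  have hYm := hg.measurable_iterate hF δ η x₀ hv t
  have hWm : Measurable fun ω i => v t i ω := measurable_pi_lambda _ fun i => hv t i
  have hmap := hg.map_iterate_prodMk hF δ η x₀ hv hlaw hindep t
  have hint := hg.integrable_norm_sq_iterate_sub (P := P) hF δ η hx₀ hv y t
  have hWn : ∀ᵐ ω ∂P, ‖(WithLp.toLp 2 (fun i => v t i ω) : Joint d)‖ ^ 2 = n := by
    filter_upwards [hnorm] with ω hω
    rw [PiLp.norm_sq_eq_of_L2]
    simp [hω]
  have hcross : Integrable (fun ω => inner ℝ (iterate X F η δ x₀ v t ω - y)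
      (WithLp.toLp 2 (fun i => v t i ω) : Joint d)) P := by
    refine Integrable.of_bound (Measurable.aestronglyMeasurable (by fun_prop))
      ((|1 - δ| * R + ‖y‖) * √(n : ℝ)) ?_
    filter_upwards [hWn] with ω hω
    refine (norm_inner_le_norm _ _).trans ?_
    have h1 := norm_sub_le (iterate X F η δ x₀ v t ω) y
    have h2 := hg.norm_iterate_le (F := F) (v := v) δ η hx₀ t ω
    have h3 := Real.le_sqrt_of_sq_le hω.le
    have h4 := hg.R_pos
    gcongr
    linarith
  -- The directions have mean zero once the independent iterate is frozen.
  have hzero : ∫ ω, inner ℝ (iterate X F η δ x₀ v t ω - y)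
      (WithLp.toLp 2 (fun i => v t i ω) : Joint d) ∂P = 0 := by
    have hh : Measurable fun p : Joint d × (∀ i, Strat (d i)) =>
        inner ℝ (p.1 - y) (WithLp.toLp 2 p.2 : Joint d) := by fun_prop
    refine (integral_comp_prodMk_of_map_eq_prod hYm hWm hmap hh hcross).2.trans ?_
    refine integral_eq_zero_of_ae (Filter.Eventually.of_forall fun ω => ?_)
    simp only [PiLp.inner_apply, Pi.zero_apply]
    simp_rw [real_inner_comm]
    rw [integral_finsetSum]
    · exact Finset.sum_eq_zero fun i _ => integral_inner_sphereProd hd i _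
    · intro i _
      refine integrable_sphereProd_of_bound hd (by fun_prop)
        (B := ‖(iterate X F η δ x₀ v t ω - y) i‖) fun w hw => ?_
      have := abs_real_inner_le_norm (w i) ((iterate X F η δ x₀ v t ω - y) i)
      rw [hw i, one_mul] at this
      exact this
  have heq : (fun ω => ‖iterate X F η δ x₀ v t ω + δ • WithLp.toLp 2 (fun i => v t i ω) - y‖ ^ 2)
      =ᵐ[P] fun ω => ‖iterate X F η δ x₀ v t ω - y‖ ^ 2 +
        (2 * δ * inner ℝ (iterate X F η δ x₀ v t ω - y)
          (WithLp.toLp 2 (fun i => v t i ω) : Joint d) + δ ^ 2 * n) := by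
    filter_upwards [hWn] with ω hω
    rw [add_sub_right_comm, norm_add_sq_real, norm_smul, mul_pow, hω, real_inner_smul_right,
      Real.norm_eq_abs, sq_abs]
    ring
  have hrest : Integrable (fun ω => 2 * δ * inner ℝ (iterate X F η δ x₀ v t ω - y)
          (WithLp.toLp 2 (fun i => v t i ω) : Joint d) + δ ^ 2 * n) P :=
    (hcross.const_mul _).add (integrable_const _)
  refine ⟨(hint.add hrest).congr heq.symm, ?_⟩
  rw [integral_congr_ae heq, integral_add hint hrest,
    integral_add (hcross.const_mul _) (integrable_const _), integral_const_mul, hzero]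
  simp

end
end BanditGame

namespace BanditGame

/-! ### Convergence rate -/

/-- The bound is a supersolution of the recursion, with slack `A / (t² (t - 1))`. -/
theorem le_add_div_of_recursion {a : ℕ → ℝ} {A B : ℝ} (hA : 0 ≤ A)
    (h : ∀ t : ℕ, 1 ≤ t → a (t + 1) ≤ (1 - 2 / t) * a t + 2 / t * B + A / t ^ 2) {t : ℕ}
    (ht : 3 ≤ t) : a t ≤ B + A / (t - 1) := by
  induction t, ht using Nat.le_induction with
  -- At `t = 2` the factor `1 - 2 / t` vanishes, so the history, including the arbitrary step `η 0`,
  -- is forgotten.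
  | base =>
    have := h 2 (by norm_num)
    norm_num at this ⊢
    linarith
  | succ t ht ih =>
    have ht' : (3 : ℝ) ≤ t := by exact_mod_cast ht
    have h1 := h t (by omega)
    have h2 : (1 - 2 / (t : ℝ)) * a t ≤ (1 - 2 / (t : ℝ)) * (B + A / (t - 1)) := by
      refine mul_le_mul_of_nonneg_left ih ?_
      rw [sub_nonneg, div_le_one (by linarith)]
      linarith
    have h3 : B + A / (t : ℝ) - ((1 - 2 / (t : ℝ)) * (B + A / (t - 1)) + 2 / t * B + A / t ^ 2) =
        A / (t ^ 2 * (t - 1)) := by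
      have : (t : ℝ) - 1 ≠ 0 := by linarith
      field_simp
      ring
    have h4 : 0 ≤ A / ((t : ℝ) ^ 2 * (t - 1)) := by
      have : 0 ≤ (t : ℝ) - 1 := by linarith
      positivity
    push_cast
    rw [add_sub_cancel_right]
    linarith

theorem norm_sub_sq_le_of_shrunk {E : Type*} [NormedAddCommGroup E] (x y z : E) :
    ‖x - z‖ ^ 2 ≤ 4 / 3 * ‖x - y‖ ^ 2 + 4 * ‖y - z‖ ^ 2 := by
  have h1 := norm_sub_le_norm_sub_add_norm_sub x y z
  have h2 := norm_nonneg (x - z)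
  nlinarith [sq_nonneg (‖x - y‖ - 3 * ‖y - z‖)]

/-- The query radius is small compared with the target accuracy. -/
theorem query_radius_bounds {n : ℕ} (hn : n ≠ 0) {α β R ε δ : ℝ} (hα : 0 < α) (hR : 0 < R)
    (hε : 0 < ε) (hαβ : α ≤ β * √(n : ℝ))
    (hδ : δ = α * √(ε / 4) / ((α + β * √(n : ℝ)) * R + β * n)) :
    0 < δ ∧ δ * R ≤ √ε / 4 ∧ δ ^ 2 * n ≤ ε / 4 ∧
      δ * (β * n + β * √(n : ℝ) * R) / α = √ε / 2 - δ * R := by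
  have hs : 0 < √(n : ℝ) := Real.sqrt_pos.2 (by exact_mod_cast Nat.pos_of_ne_zero hn)
  have hs2 : √(n : ℝ) * √(n : ℝ) = n := Real.mul_self_sqrt (Nat.cast_nonneg n)
  have hq : 0 < √ε := Real.sqrt_pos.2 hε
  have hq4 : √(ε / 4) = √ε / 2 := by
    rw [Real.sqrt_div' _ (by norm_num), show (4 : ℝ) = 2 ^ 2 by norm_num,
      Real.sqrt_sq (by norm_num)]
  have hβ : α * √(n : ℝ) ≤ β * n := by nlinarith
  rw [hq4] at hδ
  set C := (α + β * √(n : ℝ)) * R + β * n with hC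
  -- From `α ≤ β √n`: the term `β √n R` dominates `α R`, and `β n` dominates `α √n`.
  have hC1 : 2 * α * R + α * √(n : ℝ) ≤ C := by nlinarith
  have hαR : 0 < α * R := by positivity
  have hαs : 0 < α * √(n : ℝ) := by positivity
  have hC0 : 0 < C := by linarith
  have hδC : δ * C = α * (√ε / 2) := by rw [hδ]; field_simp
  have hδ0 : 0 < δ := by rw [hδ]; positivity
  refine ⟨hδ0, ?_, ?_, ?_⟩
  · have h1 : α * (2 * (δ * R)) ≤ α * (√ε / 2) := by
      rw [← hδC]
      nlinarith
    linarith [le_of_mul_le_mul_left h1 hα]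
  · have h1 : α * (δ * √(n : ℝ)) ≤ α * (√ε / 2) := by
      rw [← hδC]
      nlinarith
    have h2 := pow_le_pow_left₀ (by positivity) (le_of_mul_le_mul_left h1 hα) 2
    rw [mul_pow, div_pow, Real.sq_sqrt (Nat.cast_nonneg n), Real.sq_sqrt hε.le] at h2
    linarith
  · rw [eq_sub_iff_add_eq, ← mul_left_inj' hα.ne', add_mul, div_mul_cancel₀ _ hα.ne']
    rw [hC] at hδC
    linarith

/-- The first term of the maximum is `32 R² / ε`, which exceeds `8` when `ε < 4 R²`. The second
bounds the variance term by `(ε / 4) * t / (t - 1)`, and `t / (t - 1) ≤ 9 / 8`. -/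
theorem iteration_count_bounds {n : ℕ} (hn : n ≠ 0) {α C R ε δ S : ℝ} (hα : 0 < α) (hC : 0 < C)
    (hε : 0 < ε) (hεR : ε < 4 * R ^ 2) (hS : 0 ≤ S) (hδ : δ = α * √(ε / 4) / C) {t : ℕ}
    (ht : max (32 * α ^ 4 * ε * R ^ 2) (64 * (C + √(n : ℝ) * α) ^ 2 * S * n) / (α ^ 4 * ε ^ 2) ≤
      (t : ℝ)) :
    9 ≤ t ∧ 4 * (S / δ ^ 2) / α ^ 2 / (t - 1) ≤ 9 / 32 * ε := by
  rw [div_le_iff₀ (by positivity), max_le_iff] at ht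
  obtain ⟨h1, h2⟩ := ht
  have h9 : 8 < (t : ℝ) := by
    by_contra! h
    have h3 : (t : ℝ) * (α ^ 4 * ε ^ 2) ≤ 8 * (α ^ 4 * ε ^ 2) := by gcongr
    have h4 : α ^ 4 * ε * ε < α ^ 4 * ε * (4 * R ^ 2) := by gcongr
    nlinarith
  have ht9 : 9 ≤ t := by
    have : 8 < t := by exact_mod_cast h9
    omega
  have ht9' : (9 : ℝ) ≤ t := by exact_mod_cast ht9
  refine ⟨ht9, ?_⟩
  have hn1 : (1 : ℝ) ≤ n := by exact_mod_cast Nat.one_le_iff_ne_zero.2 hn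
  have h3 : 64 * C ^ 2 * S ≤ t * (α ^ 4 * ε ^ 2) := by
    refine le_trans ?_ h2
    calc 64 * C ^ 2 * S = 64 * C ^ 2 * S * 1 := by ring
      _ ≤ 64 * (C + √(n : ℝ) * α) ^ 2 * S * n := by
        gcongr
        exact le_add_of_nonneg_right (by positivity)
  have hδ2 : δ ^ 2 = α ^ 2 * ε / (4 * C ^ 2) := by
    rw [hδ, div_pow, mul_pow, Real.sq_sqrt (by positivity)]
    field_simp
  rw [div_le_iff₀ (by linarith), hδ2]
  have e : 4 * (S / (α ^ 2 * ε / (4 * C ^ 2))) / α ^ 2 = 64 * C ^ 2 * S / (4 * (α ^ 4 * ε)) := by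
    field_simp
    ring
  rw [e, div_le_iff₀ (by positivity)]
  refine h3.trans ?_
  have h5 : (t : ℝ) ≤ 9 / 8 * (t - 1) := by linarith
  calc (t : ℝ) * (α ^ 4 * ε ^ 2) ≤ 9 / 8 * (t - 1) * (α ^ 4 * ε ^ 2) := by gcongr
    _ = _ := by ring

/-! ### Mean-square error after `t` rounds -/

variable {n : ℕ} {d : Fin n → ℕ} {X : ∀ i : Fin n, Set (Strat (d i))}
  {f F : Fin n → Joint d → ℝ} {α β L r R : ℝ} {Ω : Type*} [MeasurableSpace Ω] {P : Measure Ω}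
  [IsProbabilityMeasure P] {v : ℕ → (i : Fin n) → Ω → Strat (d i)}

/-- Mean square distance of the iterates to the shrunk equilibrium `(1 - δ) x^⋆`. -/
theorem StandingAssumptions.integral_norm_sq_iterate_sub_shrunk_le
    (hg : StandingAssumptions X f α β L r R) (hd : ∀ i, d i ≠ 0) {δ : ℝ} (hδ0 : 0 < δ)
    (hδ1 : δ < 1)
    (hfeas : ∀ i, ∀ u ∈ X i, ∀ s : Strat (d i), ‖s‖ = 1 → (1 - δ) • u + δ • s ∈ X i)
    (hF : ∀ i, Measurable (F i)) (hFf : ∀ i, ∀ z ∈ jointSet X, F i z = f i z)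
    {xs : Joint d} (hxs : IsNash X f xs) {η : ℕ → ℝ}
    (hη : ∀ t : ℕ, 1 ≤ t → η t = 2 / (α * t)) {x₀ : Joint d}
    (hx₀ : ∀ i, x₀ i ∈ (1 - δ) • X i) (hv : ∀ s i, Measurable (v s i))
    (hlaw : ∀ s i, P.map (v s i) = uniformSphere (d i))
    (hindep : iIndepFun (fun p : ℕ × Fin n => v p.1 p.2) P) {t : ℕ} (ht : 3 ≤ t) :
    ∫ ω, ‖iterate X F η δ x₀ v t ω - (1 - δ) • xs‖ ^ 2 ∂P ≤
      (δ * (β * n + β * √(n : ℝ) * R) / α) ^ 2 +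
        4 * ((∑ i, (d i : ℝ)) ^ 2 * Fstar X f / δ ^ 2) / α ^ 2 / (t - 1) := by
  have hα := hg.α_pos
  have hF0 := Fstar_nonneg X f
  refine le_add_div_of_recursion
    (a := fun t => ∫ ω, ‖iterate X F η δ x₀ v t ω - (1 - δ) • xs‖ ^ 2 ∂P) (by positivity)
    (fun t ht => ?_) ht
  have ht' : (0 : ℝ) < t := by exact_mod_cast ht
  have hηt := hη t ht
  have := hg.integral_norm_sq_iterate_succ_le hd hδ0 hδ1 hfeas hF hFf hxs (η := η) hx₀ hv hlaw
    hindep (t := t) (by rw [hηt]; positivity)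
  refine this.trans (le_of_eq ?_)
  rw [hηt]
  field_simp
  ring

/-- Mean square distance of the iterates to the equilibrium, with room for the query noise. -/
theorem StandingAssumptions.integral_norm_sq_iterate_sub_nash_le
    (hg : StandingAssumptions X f α β L r R) (hn : n ≠ 0) (hd : ∀ i, d i ≠ 0) {ε δ : ℝ}
    (hε : 0 < ε) (hεR : ε < 4 * R ^ 2)
    (hδ : δ = α * √(ε / 4) / ((α + β * √(n : ℝ)) * R + β * n))
    (hfeas : ∀ i, ∀ u ∈ X i, ∀ s : Strat (d i), ‖s‖ = 1 → (1 - δ) • u + δ • s ∈ X i)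
    (hF : ∀ i, Measurable (F i)) (hFf : ∀ i, ∀ z ∈ jointSet X, F i z = f i z)
    {xs : Joint d} (hxs : IsNash X f xs) {η : ℕ → ℝ}
    (hη : ∀ t : ℕ, 1 ≤ t → η t = 2 / (α * t)) {x₀ : Joint d}
    (hx₀ : ∀ i, x₀ i ∈ (1 - δ) • X i) (hv : ∀ s i, Measurable (v s i))
    (hlaw : ∀ s i, P.map (v s i) = uniformSphere (d i))
    (hindep : iIndepFun (fun p : ℕ × Fin n => v p.1 p.2) P) {t : ℕ}
    (ht : max (32 * α ^ 4 * ε * R ^ 2)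
        (64 * ((α + β * √(n : ℝ)) * R + β * n + √(n : ℝ) * α) ^ 2 *
          ((∑ i, (d i : ℝ)) ^ 2 * Fstar X f) * n) / (α ^ 4 * ε ^ 2) ≤ (t : ℝ)) :
    ∫ ω, ‖iterate X F η δ x₀ v t ω - xs‖ ^ 2 ∂P ≤ 3 / 4 * ε := by
  have hα := hg.α_pos
  have hβ := hg.β_nonneg
  have hR := hg.R_pos
  have hF0 := Fstar_nonneg X f
  obtain ⟨hδ0, hδR, -, hb⟩ := query_radius_bounds hn hα hR hε
    (hg.strong_monotonicity_le_lipschitz hn hd) hδ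
  have hq0 : 0 ≤ √ε := Real.sqrt_nonneg ε
  have hq2 : √ε ^ 2 = ε := Real.sq_sqrt hε.le
  have hδ1 : δ < 1 := by
    have h1 : √ε < 2 * R := by
      rw [Real.sqrt_lt' (by positivity)]
      linarith
    have h2 : δ * R < 1 * R := by linarith
    exact lt_of_mul_lt_mul_right h2 hR.le
  obtain ⟨ht9, hA⟩ := iteration_count_bounds hn hα (by positivity) hε hεR (by positivity) hδ ht
  have key := hg.integral_norm_sq_iterate_sub_shrunk_le hd hδ0 hδ1 hfeas hF hFf hxs hη hx₀ hv hlaw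
    hindep (t := t) (by omega)
  rw [hb] at key
  have hint := hg.integrable_norm_sq_iterate_sub (P := P) hF δ η hx₀ hv xs t
  have hint' := hg.integrable_norm_sq_iterate_sub (P := P) hF δ η hx₀ hv ((1 - δ) • xs) t
  have hyx : ‖(1 - δ) • xs - xs‖ ≤ δ * R := by
    have : (1 - δ) • xs - xs = -(δ • xs) := by
      rw [sub_smul, one_smul]
      abel
    rw [this, norm_neg, norm_smul, Real.norm_of_nonneg hδ0.le]
    exact mul_le_mul_of_nonneg_left (hg.norm_le fun i => (hxs i).1) hδ0.le
  calc _ ≤ ∫ ω, (4 / 3 * ‖iterate X F η δ x₀ v t ω - (1 - δ) • xs‖ ^ 2 + 4 * (δ * R) ^ 2) ∂P := by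
        refine integral_mono hint ((hint'.const_mul _).add (integrable_const _)) fun ω => ?_
        refine (norm_sub_sq_le_of_shrunk _ ((1 - δ) • xs) _).trans ?_
        gcongr
    _ = 4 / 3 * ∫ ω, ‖iterate X F η δ x₀ v t ω - (1 - δ) • xs‖ ^ 2 ∂P + 4 * (δ * R) ^ 2 := by
        rw [integral_add (hint'.const_mul _) (integrable_const _), integral_const_mul]
        simp
    _ ≤ 3 / 4 * ε := by
        have h1 : 0 ≤ δ * R := by positivity
        -- With `p = δ R`, the total is `17 ε / 24 + (16 / 3) p (p - √ε / 4)`, and `p ≤ √ε / 4`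
        -- makes the last term nonpositive.
        nlinarith [mul_nonneg h1 (sub_nonneg.2 hδR)]

end BanditGame

/-! ### Measurable extension of the costs, coarse accuracy and the main theorem -/

namespace BanditGame
variable {n : ℕ} {d : Fin n → ℕ} {X : ∀ i : Fin n, Set (Strat (d i))}
  {f : Fin n → Joint d → ℝ} {α β L r R : ℝ}

theorem StandingAssumptions.measurable_indicator_cost (hg : StandingAssumptions X f α β L r R)
    (i : Fin n) : Measurable ((jointSet X).indicator (f i)) := by
  refine measurable_of_restrict_of_restrict_compl hg.isClosed_jointSet.measurableSet ?_ ?_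
  · have : (jointSet X).domRestrict ((jointSet X).indicator (f i)) =
        fun x : jointSet X => f i x :=
      funext fun x => Set.indicator_of_mem x.2 _
    rw [this]
    exact hg.measurable_cost i
  · have : (jointSet X)ᶜ.domRestrict ((jointSet X).indicator (f i)) = fun _ => 0 :=
      funext fun x => Set.indicator_of_notMem x.2 _
    rw [this]
    exact measurable_const

/-- The total displacement `|1 - δ| R + R` is within the target accuracy when that is coarse. -/
theorem abs_one_sub_mul_add_le {δ R ε : ℝ} (hδ0 : 0 < δ) (hR : 0 < R)
    (hδR : δ * R ≤ √ε / 4) (hεR : 4 * R ^ 2 ≤ ε) : |1 - δ| * R + R ≤ √ε := by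
  have h2R : 2 * R ≤ √ε := Real.le_sqrt_of_sq_le (by linarith)
  rcases abs_cases (1 - δ) with ⟨h, -⟩ | ⟨h, -⟩ <;> rw [h] <;> nlinarith [Real.sqrt_nonneg ε]

end BanditGame

open BanditGame

theorem mainTheorem3 {n : ℕ} {d : Fin n → ℕ}
    (X : ∀ i : Fin n, Set (BanditGame.Strat (d i)))
    (f : Fin n → BanditGame.Joint d → ℝ)
    (α β L r R : ℝ) (hgame : BanditGame.StandingAssumptions X f α β L r R)
    -- the Nash equilibrium of the game
    (xstar : BanditGame.Joint d) (hstar : BanditGame.IsNash X f xstar)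
    -- the target accuracy; the first bound is void if `L = 0` or if there is a single player
    (ε : ℝ) (hε : 0 < ε)
    (hεL : 1 < n → 0 < L →
      ε < ((α + β * √(n : ℝ)) * R + β * n) ^ 2 * (1 / (L ^ 2 * (n : ℝ) ^ 3)))
    (hεr : ε < ((α + β * √(n : ℝ)) * R + β * n) ^ 2 * (4 * r ^ 2 / α ^ 2))
    -- the query radius
    (δ : ℝ) (hδ : δ = α * √(ε / 4) / ((α + β * √(n : ℝ)) * R + β * n))
    -- the played points are feasible
    (hfeas : ∀ i, ∀ u ∈ X i, ∀ s : BanditGame.Strat (d i), ‖s‖ = 1 →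
      (1 - δ) • u + δ • s ∈ X i)
    -- the step sizes; the size of the step from `x^0` to `x^1` is arbitrary
    (η : ℕ → ℝ) (hη : ∀ t : ℕ, 1 ≤ t → η t = 2 / (α * t))
    -- the initial strategies, in `(1 - δ) 𝒳`
    (x₀ : BanditGame.Joint d) (hx₀ : ∀ i, x₀ i ∈ (1 - δ) • X i)
    -- the directions `v_i^t`: independent over `t` and `i`, each uniform on the unit sphere
    {Ω : Type*} [MeasurableSpace Ω] (P : Measure Ω) [IsProbabilityMeasure P]
    (v : ℕ → (i : Fin n) → Ω → BanditGame.Strat (d i))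
    (hlaw : ∀ t i, HasLaw (v t i) (BanditGame.uniformSphere (d i)) P)
    (hindep : iIndepFun (fun p : ℕ × Fin n => v p.1 p.2) P)
    -- the random vectors `v^t = (v_1^t, …, v_n^t)` and the iterates `x^t`
    (V : ℕ → Ω → BanditGame.Joint d) (hV : ∀ t ω, V t ω = WithLp.toLp 2 (fun i => v t i ω))
    (x : ℕ → Ω → BanditGame.Joint d)
    (hx : ∀ t ω, x t ω = BanditGame.dfo X f η δ x₀ (fun s => V s ω) t)
    (t : ℕ)
    (ht : max (32 * α ^ 4 * ε * R ^ 2)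
        (64 * ((α + β * √(n : ℝ)) * R + β * n + √(n : ℝ) * α) ^ 2 * BanditGame.Fstar X f *
          (∑ i, (d i : ℝ)) ^ 2 * n) / (α ^ 4 * ε ^ 2) ≤ (t : ℝ)) :
    (Integrable (fun ω => ‖x t ω - xstar‖ ^ 2) P ∧
      ∫ ω, ‖x t ω - xstar‖ ^ 2 ∂P ≤ ε) ∧
    (Integrable (fun ω => ‖x t ω + δ • V t ω - xstar‖ ^ 2) P ∧
      ∫ ω, ‖x t ω + δ • V t ω - xstar‖ ^ 2 ∂P ≤ ε) := by
  have hR := hgame.R_pos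
  rcases Nat.eq_zero_or_pos n with hn0 | hnpos
  · subst hn0
    have hsub : Subsingleton (Joint d) := ⟨fun a b => by ext i; exact i.elim0⟩
    have h0 : ∀ z : Joint d, ‖z‖ ^ 2 = 0 := fun z => by simp [Subsingleton.elim z 0]
    simp only [h0, integral_zero]
    exact ⟨⟨integrable_zero _ _ _, hε.le⟩, ⟨integrable_zero _ _ _, hε.le⟩⟩
  have hn : n ≠ 0 := hnpos.ne'
  have hd : ∀ i, d i ≠ 0 := fun i => ne_zero_of_isProbabilityMeasure
    ((hlaw 0 i).map_eq ▸ Measure.isProbabilityMeasure_map (hlaw 0 i).aemeasurable)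
  obtain ⟨hδ0, hδR, hδn, -⟩ := query_radius_bounds hn hgame.α_pos hR hε
    (hgame.strong_monotonicity_le_lipschitz hn hd) hδ
  set F : Fin n → Joint d → ℝ := fun i => (jointSet X).indicator (f i) with hFdef
  have hF : ∀ i, Measurable (F i) := hgame.measurable_indicator_cost
  have hFf : ∀ i, ∀ z ∈ jointSet X, F i z = f i z := fun i z hz => Set.indicator_of_mem hz _
  -- `HasLaw` gives only almost everywhere measurable directions; measurable versions keep the laws
  -- and the independence and change the iterates only on a null set.
  set u : ℕ → (i : Fin n) → Ω → Strat (d i) := fun s i => (hlaw s i).aemeasurable.mk (v s i)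
  have hu : ∀ s i, Measurable (u s i) := fun s i => (hlaw s i).aemeasurable.measurable_mk
  have hvu : ∀ s i, v s i =ᵐ[P] u s i := fun s i => (hlaw s i).aemeasurable.ae_eq_mk
  have hulaw : ∀ s i, P.map (u s i) = uniformSphere (d i) := fun s i => by
    rw [← Measure.map_congr (hvu s i), (hlaw s i).map_eq]
  have huindep : iIndepFun (fun p : ℕ × Fin n => u p.1 p.2) P :=
    hindep.congr fun p => hvu p.1 p.2
  have hunorm : ∀ᵐ ω ∂P, ∀ s i, ‖u s i ω‖ = 1 := by
    refine ae_all_iff.2 fun s => ae_all_iff.2 fun i => ?_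
    refine ae_of_ae_map (p := fun z => ‖z‖ = 1) (hu s i).aemeasurable ?_
    rw [hulaw]
    exact uniformSphere_ae_norm_eq_one (d i)
  have hVu : ∀ᵐ ω ∂P, ∀ s, V s ω = WithLp.toLp 2 (fun i => u s i ω) := by
    filter_upwards [ae_all_iff.2 fun s => ae_all_iff.2 fun i => hvu s i] with ω hω s
    simp only [hV, hω]
  have hxu : ∀ᵐ ω ∂P, x t ω = iterate X F η δ x₀ u t ω := by
    filter_upwards [hVu, hunorm] with ω h1 h2
    have e : (fun s => V s ω) = fun s => WithLp.toLp 2 (fun i => u s i ω) := funext h1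
    rw [hx, e]
    exact (hgame.dfo_congr_cost (F := F) (v := fun s => WithLp.toLp 2 fun i => u s i ω) hfeas hFf
      hx₀ h2 t).symm
  have hcongr1 : (fun ω => ‖x t ω - xstar‖ ^ 2) =ᵐ[P]
      fun ω => ‖iterate X F η δ x₀ u t ω - xstar‖ ^ 2 := by
    filter_upwards [hxu] with ω h
    rw [h]
  have hcongr2 : (fun ω => ‖x t ω + δ • V t ω - xstar‖ ^ 2) =ᵐ[P]
      fun ω => ‖iterate X F η δ x₀ u t ω + δ • WithLp.toLp 2 (fun i => u t i ω) - xstar‖ ^ 2 := by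
    filter_upwards [hxu, hVu] with ω h h'
    rw [h, h']
  rw [integrable_congr hcongr1, integrable_congr hcongr2, integral_congr_ae hcongr1,
    integral_congr_ae hcongr2]
  have hint := hgame.integrable_norm_sq_iterate_sub (P := P) hF δ η hx₀ hu xstar t
  obtain ⟨hint2, heq2⟩ := hgame.integral_norm_sq_played_sub hd hF (η := η) hx₀ hu hulaw huindep
    hunorm xstar t
  have ht' : max (32 * α ^ 4 * ε * R ^ 2)
        (64 * ((α + β * √(n : ℝ)) * R + β * n + √(n : ℝ) * α) ^ 2 *
          ((∑ i, (d i : ℝ)) ^ 2 * Fstar X f) * n) / (α ^ 4 * ε ^ 2) ≤ (t : ℝ) := by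
    refine le_trans (le_of_eq ?_) ht
    congr 2
    ring
  -- If `ε < 4 R²` then `δ < 1` and the rate applies. Otherwise both distances are at most `√ε`
  -- almost surely: for the iterate by its norm bound `|1 - δ| R`, and for the played point because
  -- it lies in `jointSet X`.
  refine ⟨⟨hint, ?_⟩, ⟨hint2, ?_⟩⟩ <;> rcases lt_or_ge ε (4 * R ^ 2) with hεR | hεR
  · have := hgame.integral_norm_sq_iterate_sub_nash_le hn hd hε hεR hδ hfeas hF hFf hstar hη hx₀ hu
      hulaw huindep ht'
    linarith
  · have hxs := hgame.norm_le fun i => (hstar i).1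
    calc _ ≤ ∫ _, ε ∂P := by
          refine integral_mono hint (integrable_const _) fun ω => ?_
          have h1 := norm_sub_le (iterate X F η δ x₀ u t ω) xstar
          have h2 := hgame.norm_iterate_le (F := F) (v := u) δ η hx₀ t ω
          have h3 := abs_one_sub_mul_add_le hδ0 hR hδR hεR
          exact (Real.le_sqrt (norm_nonneg _) hε.le).1 (by linarith)
      _ = ε := by simp
  · have := hgame.integral_norm_sq_iterate_sub_nash_le hn hd hε hεR hδ hfeas hF hFf hstar hη hx₀ hu
      hulaw huindep ht'
    linarith
  · have hxs := hgame.norm_le fun i => (hstar i).1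
    calc _ ≤ ∫ _, ε ∂P := by
          refine integral_mono_ae hint2 (integrable_const _) ?_
          filter_upwards [hunorm] with ω hω
          have hz := hgame.norm_le (add_smul_mem_of_feasible hfeas
            (w := WithLp.toLp 2 (fun i => u t i ω)) (hgame.dfo_mem (F := F) δ η hx₀
              (fun s => WithLp.toLp 2 fun i => u s i ω) t) (hω t))
          have h1 := norm_sub_le (iterate X F η δ x₀ u t ω + δ • WithLp.toLp 2 (fun i => u t i ω))
            xstar
          have h2 : 2 * R ≤ √ε := Real.le_sqrt_of_sq_le (by linarith)
          change ‖iterate X F η δ x₀ u t ω + δ • WithLp.toLp 2 (fun i => u t i ω)‖ ≤ R at hz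
          exact (Real.le_sqrt (norm_nonneg _) hε.le).1 (by linarith)
      _ = ε := by simp
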